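/- Let \(N>M>0\). Consider an ensemble of \(N\) clocks, of which the first \(N-M\) are cesium-type and the last \(M\) are hydrogen-maser-type. Let \(\tau,r>0\), let \(\sigma_{1i},\sigma_{2i}\ge 0\) (\(1\le i\le N\)) be noise standard deviations with \(\sigma_{2i}>0\) for \(i\le N-M\), and let \(\sigma_{3j}>0\) for \(N-M<j\le N\). Put \[A=\begin{pmatrix}1&\tau\\0&1\end{pmatrix},\quad \beta=\begin{pmatrix}\tau^2/2\\ \tau\end{pmatrix},\quad B=\begin{pmatrix}\tau\\1\end{pmatrix},\quad C=\begin{pmatrix}1&0\end{pmatrix},\quad J=\begin{pmatrix}0\\I_M\end{pmatrix}\in\mathbb R^{N\times M}.\] Let \(V\in\mathbb R^{(N-1)\times N}\) satisfy \(\ker V=\operatorname{span}\{\mathbf 1_N\}\). The ensemble model for \(x=(p,f)\in\mathbb R^{2N}\), \(z\in\mathbb R^M\) is \[\begin{pmatrix}x[k+1]\\z[k+1]\end{pmatrix}=\begin{pmatrix}A\otimes I_N&\beta\otimes J\\0&I_M\end{pmatrix}\begin{pmatrix}x[k]\\z[k]\end{pmatrix}+\begin{pmatrix}B\otimes I_N\\0\end{pmatrix}u[k]+v[k],\qquad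 y[k]=\begin{pmatrix}C\otimes V&0\end{pmatrix}\begin{pmatrix}x[k]\\z[k]\end{pmatrix}+w[k],\] where \(w\) has covariance \(rI_{N-1}\) and \(v\) has covariance \[Q=\begin{pmatrix}\tau\Sigma_1+\frac{\tau^3}{3}\Sigma_2+\frac{\tau^5}{20}\Sigma_3&\frac{\tau^2}{2}\Sigma_2+\frac{\tau^4}{8}\Sigma_3&\frac{\tau^3}{6}\Sigma_4\\ \frac{\tau^2}{2}\Sigma_2+\frac{\tau^4}{8}\Sigma_3&\tau\Sigma_2+\frac{\tau^3}{3}\Sigma_3&\frac{\tau^2}{2}\Sigma_4\\ \frac{\tau^3}{6}\Sigma_4^\top&\frac{\tau^2}{2}\Sigma_4^\top&\tau\Sigma_5\end{pmatrix},\] with \(\Sigma_1=\operatorname{diag}(\sigma_{1i}^2)\), \(\Sigma_2=\operatorname{diag}(\sigma_{2i}^2)\), \(\Sigma_5=\operatorname{diag}(\sigma_{3j}^2)\in\mathbb R^{M\times M}\), \(\Sigma_4=J\Sigma_5\), \(\Sigma_3=J\Sigma_5J^\top\). Let \(q\in\mathbb R^N\) with \(q^\top\mathbf 1_N=1\), let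 \(W\in\mathbb R^{N\times(N-1)}\) have full column rank with \(q^\top W=0\), and put \(V^+=W(VW)^{-1}\), \[\mathbf T_o=\begin{pmatrix}I_2\otimes V&0\\0&I_M\end{pmatrix},\quad \mathbf T_{\bar o}=\begin{pmatrix}I_2\otimes q^\top&0\end{pmatrix},\quad \mathbf T=\begin{pmatrix}\mathbf T_o\\ \mathbf T_{\bar o}\end{pmatrix},\] \[\mathbf A_{oo}=\begin{pmatrix}A\otimes I_{N-1}&\beta\otimes VJ\\0&I_M\end{pmatrix},\ \mathbf A_{\bar oo}=\begin{pmatrix}0&\beta\otimes q^\top J\end{pmatrix},\ \mathbf B_o=\begin{pmatrix}B\otimes V\\0\end{pmatrix},\ \mathbf B_{\bar o}=B\otimes q^\top,\ \mathbf C_o=\begin{pmatrix}C\otimes I_{N-1}&0\end{pmatrix},\] \[\tilde A=\begin{pmatrix}\mathbf A_{oo}&0\\ \mathbf A_{\bar oo}&A\end{pmatrix},\quad \tilde B=\begin{pmatrix}\mathbf B_o\\ \mathbf B_{\bar o}\end{pmatrix},\quad \tilde C=\begin{pmatrix}\mathbf C_o&0\end{pmatrix}.\] The transformed Kalman filter,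 started from an error covariance \(P[0]\) and an estimate \(\hat\eta[0]\), is, for \(k\ge1\), \[\hat\eta^-[k]=\tilde A\hat\eta[k-1]+\tilde Bu[k-1],\quad P^-[k]=\tilde AP[k-1]\tilde A^\top+\mathbf TQ\mathbf T^\top,\quad L[k]=P^-[k]\tilde C^\top(\tilde CP^-[k]\tilde C^\top+rI)^{-1},\] \[P[k]=(I-L[k]\tilde C)P^-[k],\qquad \hat\eta[k]=\hat\eta^-[k]+L[k](y[k]-\tilde C\hat\eta^-[k]).\] Subscripts \(oo\) and \(\bar oo\) denote the upper left and the lower left block of \(P[k]\) and \(P^-[k]\), and \(L_o[k]\), \(L_{\bar o}[k]\) the upper and the lower block of \(L[k]\). Then the following hold. 1. \(\mathbf T\) is invertible with \[\mathbf T^{-1}=\begin{pmatrix}I_2\otimes V^+&0&I_2\otimes\mathbf 1_N\\0&I_M&0\end{pmatrix},\] and it transforms the system, input and output matrices of the ensemble model into \(\tilde A,\tilde B,\tilde C\). 2. The Riccati equation \[P=\mathbf T_oQ\mathbf T_o^\top+\mathbf A_{oo}P\mathbf A_{oo}^\top-\mathbf A_{oo}P\mathbf C_o^\top(\mathbf C_oP\mathbf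 C_o^\top+rI)^{-1}\mathbf C_oP\mathbf A_{oo}^\top\] has a unique positive semidefinite solution \(P^*_{oo}\). Put \(L_o^*=P_{oo}^*\mathbf C_o^\top(\mathbf C_oP_{oo}^*\mathbf C_o^\top+rI)^{-1}\). 3. All eigenvalues of \(\mathbf A_{oo}(I-L_o^*\mathbf C_o)\) and of \(\mathbf A_{oo}(I-L_o^*\mathbf C_o)\otimes A\) lie in the open unit disc, and the linear equation \[X=\mathbf T_{\bar o}Q\mathbf T_o^\top+AX\mathbf A_{oo}^\top-AX\mathbf C_o^\top(L_o^*)^\top\mathbf A_{oo}^\top+\mathbf A_{\bar oo}P_{oo}^*\mathbf A_{oo}^\top-\mathbf A_{\bar oo}L_o^*\mathbf C_oP_{oo}^*\mathbf A_{oo}^\top\] has a unique solution \(P_{\bar oo}^*\). Put \(L_{\bar o}^*=P_{\bar oo}^*\mathbf C_o^\top(\mathbf C_oP_{oo}^*\mathbf C_o^\top+rI)^{-1}\). 4. For every positive semidefinite \(P[0]\), as \(k\to\infty\), \(P^-_{oo}[k]\to P^*_{oo}\), \(P_{oo}[k]\to(I-L_o^*\mathbf C_o)P^*_{oo}\), \(P^-_{\bar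 oo}[k]\to P^*_{\bar oo}\), \(L_o[k]\to L_o^*\) and \(L_{\bar o}[k]\to L_{\bar o}^*\). 5. The steady-state filter has constant gains: if \(P_{oo}[0]=(I-L_o^*\mathbf C_o)P_{oo}^*\) and \(P_{\bar oo}[0]=P_{\bar oo}^*(I-L_o^*\mathbf C_o)^\top\), then \(P^-_{oo}[k]=P^*_{oo}\), \(P^-_{\bar oo}[k]=P^*_{\bar oo}\), \(L_o[k]=L_o^*\), \(L_{\bar o}[k]=L_{\bar o}^*\) for all \(k\ge1\), and, for all inputs \(u\) and measurements \(y\), the transformed Kalman filter recursion for the estimates is equivalent to \[\hat\eta^-[k]=\tilde A\hat\eta[k-1]+\tilde Bu[k-1],\qquad \hat\eta[k]=\hat\eta^-[k]+\begin{pmatrix}L_o^*\\L_{\bar o}^*\end{pmatrix}\big(y[k]-\mathbf C_o\hat\eta_o^-[k]\big)\qquad(k\ge1),\] where \(\hat\eta_o^-[k]\) is the observable part (the first \(2(N-1)+M\) components) of \(\hat\eta^-[k]\). -/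

import Mathlib

open Matrix Filter Topology
open scoped Kronecker

noncomputable section

/-- The clocks of the ensemble: `c` cesium-type clocks followed by `M` hydrogen-maser-type clocks,
so that `N = c + M`. -/
abbrev Clock (c M : ℕ) : Type := Fin c ⊕ Fin M

/-- The `N - 1` measured clock-reading differences. -/
abbrev Meas (c M : ℕ) : Type := Fin (c + M - 1)

/-- Coordinates of `(x, z)`: `x = (p, f)` is indexed by `Fin 2 × Clock c M`, and `z` by the masers. -/
abbrev StateIx (c M : ℕ) : Type := (Fin 2 × Clock c M) ⊕ Fin M

/-- Coordinates of the observable state, of dimension `2 (N - 1) + M`. -/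
abbrev ObsIx (c M : ℕ) : Type := (Fin 2 × Meas c M) ⊕ Fin M

/-- Coordinates of the transformed state (observable part, then the unobservable part `ℝ²`). -/
abbrev TransIx (c M : ℕ) : Type := ObsIx c M ⊕ Fin 2

/-- The mixed ensemble: sampling interval, noise standard deviations, measurement noise variance
and measurement-pair matrix. The noise of highest order of each clock (`σ₂` for cesium clocks, `σ₃`
for masers) is nondegenerate. -/
structure MixedEnsemble (c M : ℕ) where
  τ : ℝ
  σ₁ : Clock c M → ℝ
  σ₂ : Clock c M → ℝ
  σ₃ : Fin M → ℝ
  r : ℝ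
  V : Matrix (Meas c M) (Clock c M) ℝ
  cesium_pos : 0 < c
  maser_pos : 0 < M
  τ_pos : 0 < τ
  σ₁_nonneg : ∀ i, 0 ≤ σ₁ i
  σ₂_nonneg : ∀ i, 0 ≤ σ₂ i
  σ₂_cesium_pos : ∀ i : Fin c, 0 < σ₂ (Sum.inl i)
  σ₃_pos : ∀ j, 0 < σ₃ j
  r_pos : 0 < r
  ker_V : LinearMap.ker V.mulVecLin = Submodule.span ℝ {(1 : Clock c M → ℝ)}

/-- A weight vector `q` with `qᵀ 1 = 1` and a matrix `W` of full column rank with `qᵀ W = 0`. -/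
structure Weighting (c M : ℕ) where
  q : Clock c M → ℝ
  W : Matrix (Clock c M) (Meas c M) ℝ
  q_sum : ∑ i, q i = 1
  W_rank : W.rank = c + M - 1
  q_W : q ᵥ* W = 0

/-- `b ⊗ X` for a column vector `b`, with the trivial column factor dropped. -/
def kronCol {m n : Type*} (b : Fin 2 → ℝ) (X : Matrix m n ℝ) : Matrix (Fin 2 × m) n ℝ :=
  (replicateCol Unit b ⊗ₖ X).submatrix id (fun j => ((), j))

/-- `bᵀ ⊗ X` for a row vector `bᵀ`, with the trivial row factor dropped. -/
def kronRow {m n : Type*} (b : Fin 2 → ℝ) (X : Matrix m n ℝ) : Matrix m (Fin 2 × n) ℝ :=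
  (replicateRow Unit b ⊗ₖ X).submatrix (fun i => ((), i)) id

/-- `I₂ ⊗ v` for a column vector `v`. -/
def idKronCol {m : Type*} (v : m → ℝ) : Matrix (Fin 2 × m) (Fin 2) ℝ :=
  ((1 : Matrix (Fin 2) (Fin 2) ℝ) ⊗ₖ replicateCol Unit v).submatrix id (fun a => (a, ()))

/-- `I₂ ⊗ vᵀ` for a row vector `vᵀ`. -/
def idKronRow {m : Type*} (v : m → ℝ) : Matrix (Fin 2) (Fin 2 × m) ℝ :=
  ((1 : Matrix (Fin 2) (Fin 2) ℝ) ⊗ₖ replicateRow Unit v).submatrix (fun a => (a, ())) id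

/-- All complex eigenvalues of the real square matrix `X` lie in the open unit disc. -/
def IsSchurStable {n : Type*} [Fintype n] [DecidableEq n] (X : Matrix n n ℝ) : Prop :=
  ∀ μ ∈ spectrum ℂ (X.map (algebraMap ℝ ℂ)), ‖μ‖ < 1

namespace MixedEnsemble

variable {c M : ℕ} (E : MixedEnsemble c M) (D : Weighting c M)

/-! The single-clock matrices. -/

def A : Matrix (Fin 2) (Fin 2) ℝ := !![1, E.τ; 0, 1]

def β : Fin 2 → ℝ := ![E.τ ^ 2 / 2, E.τ]

def B : Fin 2 → ℝ := ![E.τ, 1]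

def C (_ : MixedEnsemble c M) : Fin 2 → ℝ := ![1, 0]

/-- `J` embeds the masers into the clocks. -/
def J (_ : MixedEnsemble c M) : Matrix (Clock c M) (Fin M) ℝ := fromRows 0 1

/-! The ensemble model `(x, z)[k+1] = 𝒜 (x, z)[k] + ℬ u[k] + v[k]`, `y[k] = 𝒞 (x, z)[k] + w[k]`. -/

def ensA : Matrix (StateIx c M) (StateIx c M) ℝ :=
  fromBlocks (E.A ⊗ₖ (1 : Matrix (Clock c M) (Clock c M) ℝ)) (kronCol E.β E.J) 0 1

def ensB : Matrix (StateIx c M) (Clock c M) ℝ :=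
  fromRows (kronCol E.B (1 : Matrix (Clock c M) (Clock c M) ℝ)) 0

def ensC : Matrix (Meas c M) (StateIx c M) ℝ := fromCols (kronRow E.C E.V) 0

def Sig1 : Matrix (Clock c M) (Clock c M) ℝ := diagonal fun i => E.σ₁ i ^ 2

def Sig2 : Matrix (Clock c M) (Clock c M) ℝ := diagonal fun i => E.σ₂ i ^ 2

def Sig3 : Matrix (Clock c M) (Clock c M) ℝ :=
  diagonal (Sum.elim (fun _ => 0) fun j => E.σ₃ j ^ 2)

def Sig4 : Matrix (Clock c M) (Fin M) ℝ := fromRows 0 (diagonal fun j => E.σ₃ j ^ 2)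

def Sig5 : Matrix (Fin M) (Fin M) ℝ := diagonal fun j => E.σ₃ j ^ 2

/-- The covariance of the process noise of the `x`-component `(p, f)`. -/
def Qx : Matrix (Fin 2 × Clock c M) (Fin 2 × Clock c M) ℝ :=
  Matrix.comp (Fin 2) (Fin 2) (Clock c M) (Clock c M) ℝ
    !![E.τ • E.Sig1 + (E.τ ^ 3 / 3) • E.Sig2 + (E.τ ^ 5 / 20) • E.Sig3,
        (E.τ ^ 2 / 2) • E.Sig2 + (E.τ ^ 4 / 8) • E.Sig3;
      (E.τ ^ 2 / 2) • E.Sig2 + (E.τ ^ 4 / 8) • E.Sig3,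
        E.τ • E.Sig2 + (E.τ ^ 3 / 3) • E.Sig3]

/-- The covariance of the process noise between the `x`- and the `z`-component. -/
def Qxz : Matrix (Fin 2 × Clock c M) (Fin M) ℝ := kronCol ![E.τ ^ 3 / 6, E.τ ^ 2 / 2] E.Sig4

/-- The process noise covariance. -/
def Q : Matrix (StateIx c M) (StateIx c M) ℝ := fromBlocks E.Qx E.Qxz E.Qxzᵀ (E.τ • E.Sig5)

/-! The observable canonical decomposition. -/

/-- The generalized inverse `V⁺ = W (V W)⁻¹`. -/
def Vplus : Matrix (Clock c M) (Meas c M) ℝ := D.W * (E.V * D.W)⁻¹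

def To : Matrix (ObsIx c M) (StateIx c M) ℝ :=
  fromBlocks ((1 : Matrix (Fin 2) (Fin 2) ℝ) ⊗ₖ E.V) 0 0 1

def Tu (_ : MixedEnsemble c M) (D : Weighting c M) : Matrix (Fin 2) (StateIx c M) ℝ :=
  fromCols (idKronRow D.q) 0

def T : Matrix (TransIx c M) (StateIx c M) ℝ := fromRows E.To (E.Tu D)

def Tinv : Matrix (StateIx c M) (TransIx c M) ℝ :=
  fromCols (fromBlocks ((1 : Matrix (Fin 2) (Fin 2) ℝ) ⊗ₖ E.Vplus D) 0 0 1)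
    (fromRows (idKronCol 1) 0)

/-! The transformed realization. The index `u` stands for the unobservable part. -/

def Aoo : Matrix (ObsIx c M) (ObsIx c M) ℝ :=
  fromBlocks (E.A ⊗ₖ (1 : Matrix (Meas c M) (Meas c M) ℝ)) (kronCol E.β (E.V * E.J)) 0 1

def Auo : Matrix (Fin 2) (ObsIx c M) ℝ :=
  fromCols 0 (Matrix.of fun a j => E.β a * (D.q ᵥ* E.J) j)

def Bo : Matrix (ObsIx c M) (Clock c M) ℝ := fromRows (kronCol E.B E.V) 0

def Bu : Matrix (Fin 2) (Clock c M) ℝ := Matrix.of fun a i => E.B a * D.q i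

def Co : Matrix (Meas c M) (ObsIx c M) ℝ :=
  fromCols (kronRow E.C (1 : Matrix (Meas c M) (Meas c M) ℝ)) 0

def transA : Matrix (TransIx c M) (TransIx c M) ℝ := fromBlocks E.Aoo 0 (E.Auo D) E.A

def transB : Matrix (TransIx c M) (Clock c M) ℝ := fromRows E.Bo (E.Bu D)

def transC : Matrix (Meas c M) (TransIx c M) ℝ := fromCols E.Co 0

/-! The Kalman filter of the transformed realization. -/

/-- Time update of the error covariance. -/
def predictCov (P : Matrix (TransIx c M) (TransIx c M) ℝ) :
    Matrix (TransIx c M) (TransIx c M) ℝ :=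
  E.transA D * P * (E.transA D)ᵀ + E.T D * E.Q * (E.T D)ᵀ

/-- The Kalman gain belonging to a prior error covariance. -/
def kalmanGain (P : Matrix (TransIx c M) (TransIx c M) ℝ) :
    Matrix (TransIx c M) (Meas c M) ℝ :=
  P * E.transCᵀ * (E.transC * P * E.transCᵀ + E.r • 1)⁻¹

/-- Measurement update of the error covariance. -/
def updateCov (P : Matrix (TransIx c M) (TransIx c M) ℝ) :
    Matrix (TransIx c M) (TransIx c M) ℝ :=
  (1 - E.kalmanGain P * E.transC) * P

/-- The posterior error covariance at time `k`, started from `P₀` at time `0`. -/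
def postCov (P₀ : Matrix (TransIx c M) (TransIx c M) ℝ) :
    ℕ → Matrix (TransIx c M) (TransIx c M) ℝ
  | 0 => P₀
  | k + 1 => E.updateCov (E.predictCov D (postCov P₀ k))

/-- The prior error covariance at time `k + 1`. -/
def priorCov (P₀ : Matrix (TransIx c M) (TransIx c M) ℝ) (k : ℕ) :
    Matrix (TransIx c M) (TransIx c M) ℝ :=
  E.predictCov D (E.postCov D P₀ k)

/-- The observable Kalman gain at time `k + 1`. -/
def gainObs (P₀ : Matrix (TransIx c M) (TransIx c M) ℝ) (k : ℕ) :
    Matrix (ObsIx c M) (Meas c M) ℝ :=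
  (E.kalmanGain (E.priorCov D P₀ k)).toRows₁

/-- The unobservable Kalman gain at time `k + 1`. -/
def gainUnobs (P₀ : Matrix (TransIx c M) (TransIx c M) ℝ) (k : ℕ) :
    Matrix (Fin 2) (Meas c M) ℝ :=
  (E.kalmanGain (E.priorCov D P₀ k)).toRows₂

/-- `ηm k` and `η k` are the prior and posterior estimates of the Kalman filter of the transformed
realization with initial error covariance `P₀`, input `u` and measurements `y`. -/
def IsTransformedKalmanFilter (P₀ : Matrix (TransIx c M) (TransIx c M) ℝ)
    (u : ℕ → Clock c M → ℝ) (y : ℕ → Meas c M → ℝ) (ηm η : ℕ → TransIx c M → ℝ) : Prop :=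
  ∀ k, ηm (k + 1) = E.transA D *ᵥ η k + E.transB D *ᵥ u k ∧
    η (k + 1) = ηm (k + 1) +
      E.kalmanGain (E.priorCov D P₀ k) *ᵥ (y (k + 1) - E.transC *ᵥ ηm (k + 1))

/-- `ηm k` and `η k` are the prior and posterior estimates of the filter with the constant gains
`Lo` and `Lu`. -/
def IsConstantGainFilter (Lo : Matrix (ObsIx c M) (Meas c M) ℝ) (Lu : Matrix (Fin 2) (Meas c M) ℝ)
    (u : ℕ → Clock c M → ℝ) (y : ℕ → Meas c M → ℝ) (ηm η : ℕ → TransIx c M → ℝ) : Prop :=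
  ∀ k, ηm (k + 1) = E.transA D *ᵥ η k + E.transB D *ᵥ u k ∧
    η (k + 1) = ηm (k + 1) +
      fromRows Lo Lu *ᵥ (y (k + 1) - E.Co *ᵥ fun i => ηm (k + 1) (Sum.inl i))

/-! Steady state. -/

/-- `P` is a positive semidefinite solution of the Riccati equation of the observable part. -/
def IsRiccatiSolution (P : Matrix (ObsIx c M) (ObsIx c M) ℝ) : Prop :=
  P.PosSemidef ∧
    P = E.To * E.Q * E.Toᵀ + E.Aoo * P * E.Aooᵀ -
      E.Aoo * P * E.Coᵀ * (E.Co * P * E.Coᵀ + E.r • 1)⁻¹ * E.Co * P * E.Aooᵀ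

/-- The steady-state observable gain. -/
def steadyGainObs (P : Matrix (ObsIx c M) (ObsIx c M) ℝ) : Matrix (ObsIx c M) (Meas c M) ℝ :=
  P * E.Coᵀ * (E.Co * P * E.Coᵀ + E.r • 1)⁻¹

/-- The steady-state unobservable gain. -/
def steadyGainUnobs (P : Matrix (ObsIx c M) (ObsIx c M) ℝ) (X : Matrix (Fin 2) (ObsIx c M) ℝ) :
    Matrix (Fin 2) (Meas c M) ℝ :=
  X * E.Coᵀ * (E.Co * P * E.Coᵀ + E.r • 1)⁻¹

/-- `X` solves the linear equation for the steady-state cross-covariance. -/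
def IsSteinSolution (P : Matrix (ObsIx c M) (ObsIx c M) ℝ) (X : Matrix (Fin 2) (ObsIx c M) ℝ) :
    Prop :=
  X = E.Tu D * E.Q * E.Toᵀ + E.A * X * E.Aooᵀ - E.A * X * E.Coᵀ * (E.steadyGainObs P)ᵀ * E.Aooᵀ
    + E.Auo D * P * E.Aooᵀ - E.Auo D * E.steadyGainObs P * E.Co * P * E.Aooᵀ

end MixedEnsemble

end

/-!
# Steady state of the Kalman filter for a mixed clock ensemble

Write `F = A_oo`, `H = C_o`, `G = T_o Q T_oᵀ`, `R = r I`. The observable block of the prior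
covariance evolves by the Riccati map `Φ(P) = F (I - L H) P Fᵀ + G`, where `L` is the gain of `P`,
and everything rests on two identities for the closed-loop matrix `Γ(P) = F (I - L H)`:

* `Φ(P) - Φ(P') = Γ(P) (P - P') Γ(P')ᵀ` (`Riccati.step_sub_step`);
* `Φ(P) = (F - K H) P (F - K H)ᵀ + K R Kᵀ + G` minus a positive semidefinite square, for each gain
  `K` (`Riccati.step_add_square`); for `K = F L` the square vanishes.

Two properties of the clock ensemble enter. The process noise `Q` is positive definite
(`MixedEnsemble.Q_posDef`), since the noise of highest order of a clock reaches all its integrators;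
hence so is `G`. And there is a gain `K` with `(F - K H)³ = 0`
(`MixedEnsemble.exists_deadbeat_gain`), since a cesium clock makes `V J` injective. The second property
bounds `Φᵏ(P)` for `k ≥ 3` by a matrix that does not depend on `P`, and with the first one this yields `ε Φᵏ(P) ≤ G` for some
`ε > 0`. The Joseph form then gives `Γ P Γᵀ ≤ (1 - ε) Φ(P)` along the orbit, so products of
closed-loop matrices decay exponentially, uniformly in the initial covariance
(`Riccati.exists_transition_bound`). By the first identity the iterates form a Cauchy sequence, and
any two orbits approach each other. This gives existence and uniqueness of the fixed point, the
convergence of every orbit, and the decay of the powers of the closed-loop matrix, hence its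
stability. No monotonicity of the Riccati map and no spectral theory is needed.

The clock matrix `A` is unipotent with `(A - I)² = 0`, so recursions driven by `A` grow at most
quadratically, and the exponential decay of the closed-loop products wins. This settles the
stability of the Kronecker product, the solvability of the Stein equation
(`Riccati.existsUnique_stein`), and, as the error of the cross-covariance is a quadratically growing
factor times the transpose of a decaying one, its convergence (`Riccati.tendsto_cross`).
-/

set_option linter.unusedSectionVars false

noncomputable section

/-! ### The Riccati map -/

namespace Riccati

open scoped MatrixOrder

variable {m n : Type*} [Fintype m] [DecidableEq m] [Fintype n] [DecidableEq n]

/-- The Kalman gain `P Hᵀ (H P Hᵀ + R)⁻¹` of a prior covariance `P`. -/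
def gain (H : Matrix m n ℝ) (R : Matrix m m ℝ) (P : Matrix n n ℝ) : Matrix n m ℝ :=
  P * Hᵀ * (H * P * Hᵀ + R)⁻¹

/-- The closed-loop matrix `F (I - L H)` of the one-step predictor with the gain `L` of `P`. -/
def closedLoop (F : Matrix n n ℝ) (H : Matrix m n ℝ) (R : Matrix m m ℝ) (P : Matrix n n ℝ) :
    Matrix n n ℝ :=
  F * (1 - gain H R P * H)

/-- The Riccati map, sending a prior covariance to the next prior covariance. -/
def step (F : Matrix n n ℝ) (H : Matrix m n ℝ) (G : Matrix n n ℝ) (R : Matrix m m ℝ)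
    (P : Matrix n n ℝ) : Matrix n n ℝ :=
  F * ((1 - gain H R P * H) * P) * Fᵀ + G

/-- The product `Γₖ₋₁ ⋯ Γ₁ Γ₀` of the closed-loop matrices `Γᵢ` along the orbit of `P` under the
Riccati map. -/
def transition (F : Matrix n n ℝ) (H : Matrix m n ℝ) (G : Matrix n n ℝ) (R : Matrix m m ℝ)
    (P : Matrix n n ℝ) : ℕ → Matrix n n ℝ
  | 0 => 1
  | k + 1 => closedLoop F H R ((step F H G R)^[k] P) * transition F H G R P k

variable {F : Matrix n n ℝ} {H : Matrix m n ℝ} {G : Matrix n n ℝ} {R : Matrix m m ℝ}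
  {P P' : Matrix n n ℝ}

lemma posSemidef_conj {l : Type*} [Fintype l] (hP : P.PosSemidef) (X : Matrix l n ℝ) :
    (X * P * Xᵀ).PosSemidef := by
  simpa using hP.mul_mul_conjTranspose_same X

lemma conj_le_conj (h : P ≤ P') (X : Matrix n n ℝ) : X * P * Xᵀ ≤ X * P' * Xᵀ :=
  star_right_conjugate_le_conjugate h X

lemma innovation_posDef (hR : R.PosDef) (hP : P.PosSemidef) : (H * P * Hᵀ + R).PosDef :=
  hR.posSemidef_add (posSemidef_conj hP H)

lemma isUnit_det_innovation (hR : R.PosDef) (hP : P.PosSemidef) :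
    IsUnit (H * P * Hᵀ + R).det :=
  (Matrix.isUnit_iff_isUnit_det _).1 (innovation_posDef hR hP).isUnit

lemma gain_mul_innovation (hR : R.PosDef) (hP : P.PosSemidef) :
    gain H R P * (H * P * Hᵀ + R) = P * Hᵀ :=
  Matrix.nonsing_inv_mul_cancel_right _ _ (isUnit_det_innovation hR hP)

lemma innovation_mul_gain_transpose (hR : R.PosDef) (hP : P.PosSemidef) :
    (H * P * Hᵀ + R) * (gain H R P)ᵀ = H * P := by
  have hS : (H * P * Hᵀ + R)ᵀ = H * P * Hᵀ + R := by
    simpa using (innovation_posDef (H := H) hR hP).isHermitian.eq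
  have hPt : Pᵀ = P := by simpa using hP.isHermitian.eq
  have h := congrArg transpose (gain_mul_innovation (H := H) hR hP)
  rwa [transpose_mul, transpose_mul, transpose_transpose, hS, hPt] at h

/-- The posterior covariance `(I - L H) P` is symmetric. -/
lemma one_sub_gain_mul (hR : R.PosDef) (hP : P.PosSemidef) :
    (1 - gain H R P * H) * P = P * (1 - gain H R P * H)ᵀ := by
  have h1 := gain_mul_innovation (H := H) hR hP
  have h2 := innovation_mul_gain_transpose (H := H) hR hP
  have h3 : gain H R P * (H * P) = P * Hᵀ * (gain H R P)ᵀ := by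
    rw [← h2, ← Matrix.mul_assoc, h1]
  rw [transpose_sub, transpose_one, transpose_mul, Matrix.sub_mul, Matrix.mul_sub, Matrix.mul_assoc,
    h3, Matrix.one_mul, Matrix.mul_one, Matrix.mul_assoc]

lemma one_sub_gain_mul_mul_transpose (hR : R.PosDef) (hP : P.PosSemidef) :
    (1 - gain H R P * H) * P * Hᵀ = gain H R P * R := by
  have h1 := gain_mul_innovation (H := H) hR hP
  rw [Matrix.mul_add, ← eq_sub_iff_add_eq'] at h1
  rw [h1]
  simp only [Matrix.sub_mul, Matrix.mul_assoc, Matrix.one_mul]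

lemma step_eq (hR : R.PosDef) (hP : P.PosSemidef) :
    step F H G R P = F * P * (closedLoop F H R P)ᵀ + G := by
  rw [step, one_sub_gain_mul hR hP, closedLoop, transpose_mul]
  simp only [Matrix.mul_assoc]

lemma step_eq_closedLoop_mul : step F H G R P = closedLoop F H R P * P * Fᵀ + G := by
  rw [step, closedLoop]
  simp only [Matrix.mul_assoc]

lemma closedLoop_mul_mul_transpose (hR : R.PosDef) (hP : P.PosSemidef) :
    closedLoop F H R P * P * Hᵀ = F * gain H R P * R := by
  rw [closedLoop, Matrix.mul_assoc, Matrix.mul_assoc, ← Matrix.mul_assoc _ P,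
    one_sub_gain_mul_mul_transpose hR hP, Matrix.mul_assoc]

/-- The mixed form of the Riccati map; for `P' = P` it is the Joseph form. -/
lemma closedLoop_mul_mul_closedLoop_transpose (hR : R.PosDef) (hP : P.PosSemidef)
    (P' : Matrix n n ℝ) :
    closedLoop F H R P * P * (closedLoop F H R P')ᵀ =
      step F H G R P - G - F * gain H R P * R * (F * gain H R P')ᵀ := by
  have h : (closedLoop F H R P')ᵀ = Fᵀ - Hᵀ * (F * gain H R P')ᵀ := by
    rw [closedLoop, ← transpose_mul, ← transpose_sub]
    congr 1
    simp only [Matrix.mul_sub, Matrix.mul_assoc, Matrix.mul_one]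
  rw [h, Matrix.mul_sub, ← Matrix.mul_assoc _ Hᵀ, closedLoop_mul_mul_transpose hR hP,
    step_eq_closedLoop_mul, add_sub_cancel_right]

lemma transpose_eq_of_posSemidef (hP : P.PosSemidef) : Pᵀ = P := by
  simpa using hP.isHermitian.eq

lemma transpose_eq_of_posDef (hR : R.PosDef) : Rᵀ = R := by
  simpa using hR.isHermitian.eq

lemma step_transpose (hR : R.PosDef) (hG : G.PosSemidef) (hP : P.PosSemidef) :
    (step F H G R P)ᵀ = step F H G R P := by
  conv_lhs => rw [step_eq_closedLoop_mul, transpose_add, transpose_mul, transpose_mul,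
    transpose_transpose, transpose_eq_of_posSemidef hG, transpose_eq_of_posSemidef hP,
    ← Matrix.mul_assoc]
  rw [step_eq hR hP]

/-- The difference of two Riccati steps factors through both closed-loop matrices. -/
lemma step_sub_step (hR : R.PosDef) (hG : G.PosSemidef) (hP : P.PosSemidef)
    (hP' : P'.PosSemidef) :
    step F H G R P - step F H G R P' =
      closedLoop F H R P * (P - P') * (closedLoop F H R P')ᵀ := by
  have h1 := closedLoop_mul_mul_closedLoop_transpose (F := F) (H := H) (G := G) hR hP P'
  have h2 := congrArg transpose
    (closedLoop_mul_mul_closedLoop_transpose (F := F) (H := H) (G := G) hR hP' P)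
  rw [transpose_sub, transpose_sub, step_transpose hR hG hP', transpose_eq_of_posSemidef hG] at h2
  simp only [transpose_mul _ (_)ᵀ, transpose_mul _ P', transpose_mul _ R, transpose_transpose,
    transpose_eq_of_posSemidef hP', transpose_eq_of_posDef hR, ← Matrix.mul_assoc] at h2
  rw [Matrix.mul_sub, Matrix.sub_mul, h1, h2]
  abel

/-- Completion of the square: the Riccati map minimises the error covariance over all gains. -/
lemma step_add_square (hR : R.PosDef) (hP : P.PosSemidef) (K : Matrix n m ℝ) :
    step F H G R P +
        (K - F * gain H R P) * (H * P * Hᵀ + R) * (K - F * gain H R P)ᵀ =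
      (F - K * H) * P * (F - K * H)ᵀ + (K * R * Kᵀ + G) := by
  have h1 := gain_mul_innovation (H := H) hR hP
  have h2 := innovation_mul_gain_transpose (H := H) hR hP
  set S := H * P * Hᵀ + R with hS
  set L := gain H R P with hL
  have e1 : (K - F * L) * S * (K - F * L)ᵀ =
      K * S * Kᵀ - K * (S * Lᵀ) * Fᵀ - F * (L * S) * Kᵀ + F * L * (S * Lᵀ) * Fᵀ := by
    rw [transpose_sub, transpose_mul]
    simp only [Matrix.mul_sub, Matrix.sub_mul, Matrix.mul_assoc]
    abel
  have e2 : step F H G R P = F * P * Fᵀ - F * L * (H * P) * Fᵀ + G := by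
    rw [step, ← hL]
    simp only [Matrix.mul_sub, Matrix.sub_mul, Matrix.mul_assoc, Matrix.one_mul]
  have e3 : (F - K * H) * P * (F - K * H)ᵀ + (K * R * Kᵀ + G) =
      F * P * Fᵀ - F * (P * Hᵀ) * Kᵀ - K * (H * P) * Fᵀ + K * (H * P * Hᵀ + R) * Kᵀ + G := by
    rw [transpose_sub, transpose_mul]
    simp only [Matrix.mul_add, Matrix.add_mul, Matrix.mul_sub, Matrix.sub_mul, Matrix.mul_assoc]
    abel
  rw [e1, e2, e3, h1, h2, ← hS]
  abel

lemma step_le (hR : R.PosDef) (hP : P.PosSemidef) (K : Matrix n m ℝ) :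
    step F H G R P ≤ (F - K * H) * P * (F - K * H)ᵀ + (K * R * Kᵀ + G) := by
  rw [← step_add_square hR hP K]
  exact le_add_of_nonneg_right
    (posSemidef_conj (innovation_posDef hR hP).posSemidef _).nonneg

lemma closedLoop_conj_add_le_step (hR : R.PosDef) (hP : P.PosSemidef) :
    closedLoop F H R P * P * (closedLoop F H R P)ᵀ + G ≤ step F H G R P := by
  rw [closedLoop_mul_mul_closedLoop_transpose (G := G) hR hP P]
  have := (posSemidef_conj hR.posSemidef (F * gain H R P)).nonneg
  rw [← sub_nonneg]
  convert this using 1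
  abel

lemma le_step (hR : R.PosDef) (hP : P.PosSemidef) : G ≤ step F H G R P :=
  (le_add_of_nonneg_left (posSemidef_conj hP _).nonneg).trans (closedLoop_conj_add_le_step hR hP)

lemma step_posSemidef (hR : R.PosDef) (hG : G.PosSemidef) (hP : P.PosSemidef) :
    (step F H G R P).PosSemidef :=
  (hG.nonneg.trans (le_step hR hP)).posSemidef

/-- The difference of the closed-loop matrices in terms of the difference of the covariances. -/
lemma closedLoop_sub_closedLoop (hR : R.PosDef) (hP : P.PosSemidef) (hP' : P'.PosSemidef) :
    closedLoop F H R P - closedLoop F H R P' =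
      -(closedLoop F H R P * (P - P') * Hᵀ * (H * P' * Hᵀ + R)⁻¹ * H) := by
  have h0 : closedLoop F H R P * (P - P') * Hᵀ =
      (F * gain H R P - F * gain H R P') * (H * P' * Hᵀ + R) := by
    rw [Matrix.mul_sub, Matrix.sub_mul, closedLoop_mul_mul_transpose hR hP, Matrix.sub_mul,
      Matrix.mul_assoc F (gain H R P'), gain_mul_innovation hR hP', closedLoop]
    simp only [Matrix.mul_add, Matrix.mul_sub, Matrix.sub_mul, Matrix.mul_assoc, Matrix.mul_one]
    abel
  rw [h0, Matrix.mul_nonsing_inv_cancel_right _ _ (isUnit_det_innovation hR hP'), closedLoop,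
    closedLoop]
  simp only [Matrix.mul_sub, Matrix.sub_mul, Matrix.mul_assoc, Matrix.mul_one]
  abel

end Riccati

/-! ### Exponential forgetting of the initial covariance -/

namespace Riccati

open scoped MatrixOrder

attribute [local instance] Matrix.frobeniusNormedAddCommGroup Matrix.frobeniusNormedSpace

variable {m n : Type*} [Fintype m] [DecidableEq m] [Fintype n] [DecidableEq n]
variable {F : Matrix n n ℝ} {H : Matrix m n ℝ} {G : Matrix n n ℝ} {R : Matrix m m ℝ}
  {P P' : Matrix n n ℝ}

lemma exists_smul_one_le (hG : G.PosDef) : ∃ g : ℝ, 0 < g ∧ g • (1 : Matrix n n ℝ) ≤ G := by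
  cases isEmpty_or_nonempty n
  · exact ⟨1, one_pos, (Subsingleton.elim _ _).le⟩
  have h := (CFC.exists_pos_algebraMap_le_iff (a := G) hG.isHermitian).2
    fun x hx => (isStrictlyPositive_iff_posDef.2 hG).spectrum_pos hx
  simpa [Algebra.algebraMap_eq_smul_one] using h

lemma exists_le_smul_one (hP : P.PosSemidef) :
    ∃ b : ℝ, 0 < b ∧ P ≤ b • (1 : Matrix n n ℝ) := by
  obtain ⟨b, hb⟩ := (ContinuousFunctionalCalculus.isCompact_spectrum (R := ℝ) P).bddAbove
  refine ⟨max b 1, by positivity, ?_⟩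
  rw [← Algebra.algebraMap_eq_smul_one]
  exact le_algebraMap_of_spectrum_le (fun x hx => (hb hx).trans (le_max_left _ _)) hP.isHermitian

lemma exists_smul_le (hG : G.PosDef) (hP : P.PosSemidef) :
    ∃ ε : ℝ, 0 < ε ∧ ε < 1 ∧ ε • P ≤ G := by
  obtain ⟨g, hg, hgG⟩ := exists_smul_one_le hG
  obtain ⟨b, hb, hPb⟩ := exists_le_smul_one hP
  refine ⟨min (g / b) (1 / 2), by positivity, by
    have := min_le_right (g / b) (1 / 2); linarith, ?_⟩
  calc min (g / b) (1 / 2) • P ≤ (g / b) • P := by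
        rw [← sub_nonneg, ← sub_smul]
        exact smul_nonneg (sub_nonneg.2 (min_le_left _ _)) hP.nonneg
    _ ≤ (g / b) • (b • (1 : Matrix n n ℝ)) := smul_le_smul_of_nonneg_left hPb (by positivity)
    _ = g • (1 : Matrix n n ℝ) := by rw [smul_smul, div_mul_cancel₀ _ hb.ne']
    _ ≤ G := hgG

lemma iterate_posSemidef (hR : R.PosDef) (hG : G.PosSemidef) (hP : P.PosSemidef) (k : ℕ) :
    ((step F H G R)^[k] P).PosSemidef := by
  induction k with
  | zero => exact hP
  | succ k ih =>
    rw [Function.iterate_succ_apply']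
    exact step_posSemidef hR hG ih

/-- A fixed gain `K` gives an upper bound for the Riccati iterates. -/
lemma iterate_le (hR : R.PosDef) (hG : G.PosSemidef) (hP : P.PosSemidef) (K : Matrix n m ℝ)
    (k : ℕ) :
    (step F H G R)^[k] P ≤ (F - K * H) ^ k * P * ((F - K * H) ^ k)ᵀ +
      ∑ i ∈ Finset.range k, (F - K * H) ^ i * (K * R * Kᵀ + G) * ((F - K * H) ^ i)ᵀ := by
  induction k with
  | zero => simp
  | succ k ih =>
    rw [Function.iterate_succ_apply']
    refine (step_le hR (iterate_posSemidef hR hG hP k) K).trans ?_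
    refine (add_le_add_left (conj_le_conj ih (F - K * H)) _).trans_eq ?_
    rw [Matrix.mul_add, Matrix.add_mul, Finset.sum_range_succ', Finset.mul_sum, Finset.sum_mul,
      pow_succ', transpose_mul]
    simp only [pow_zero, transpose_one, Matrix.mul_one, Matrix.one_mul, pow_succ', transpose_mul,
      Matrix.mul_assoc, add_assoc]

/-- With a deadbeat gain, the Riccati iterates are eventually below a bound that does not depend on
the initial covariance. -/
lemma exists_iterate_le (hR : R.PosDef) (hG : G.PosSemidef) {K : Matrix n m ℝ} {d : ℕ}
    (hK : (F - K * H) ^ d = 0) :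
    ∃ B : Matrix n n ℝ, B.PosSemidef ∧
      ∀ P : Matrix n n ℝ, P.PosSemidef → ∀ k, (step F H G R)^[k + d] P ≤ B := by
  refine ⟨∑ i ∈ Finset.range d, (F - K * H) ^ i * (K * R * Kᵀ + G) * ((F - K * H) ^ i)ᵀ,
    posSemidef_sum _ fun i _ => posSemidef_conj ((posSemidef_conj hR.posSemidef K).add hG) _,
    fun P hP k => ?_⟩
  rw [add_comm k d, Function.iterate_add_apply]
  simpa [hK] using iterate_le (F := F) (H := H) hR hG (iterate_posSemidef hR hG hP k) K d

/-- The covariance, transported by the closed-loop matrices, contracts along the orbit. -/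
lemma transition_conj_le (hR : R.PosDef) (hG : G.PosSemidef) (hP : P.PosSemidef) {ε : ℝ}
    (hε₁ : ε < 1) (hε : ∀ k, ε • (step F H G R)^[k] P ≤ G) (k : ℕ) :
    transition F H G R P k * P * (transition F H G R P k)ᵀ ≤
      (1 - ε) ^ k • (step F H G R)^[k] P := by
  induction k with
  | zero => simp [transition]
  | succ k ih =>
    set Pk := (step F H G R)^[k] P with hPk
    have hPkp : Pk.PosSemidef := iterate_posSemidef hR hG hP k
    have h1 : closedLoop F H R Pk * Pk * (closedLoop F H R Pk)ᵀ ≤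
        (1 - ε) • step F H G R Pk := by
      have h2 := closedLoop_conj_add_le_step (F := F) (H := H) (G := G) hR hPkp
      have h3 := hε (k + 1)
      rw [Function.iterate_succ_apply', ← hPk] at h3
      rw [sub_smul, one_smul]
      exact (le_sub_iff_add_le.2 h2).trans (sub_le_sub_left h3 _)
    calc transition F H G R P (k + 1) * P * (transition F H G R P (k + 1))ᵀ
        = closedLoop F H R Pk * (transition F H G R P k * P * (transition F H G R P k)ᵀ) *
            (closedLoop F H R Pk)ᵀ := by
          rw [transition, transpose_mul]
          simp only [Matrix.mul_assoc, ← hPk]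
      _ ≤ closedLoop F H R Pk * ((1 - ε) ^ k • Pk) * (closedLoop F H R Pk)ᵀ := conj_le_conj ih _
      _ = (1 - ε) ^ k • (closedLoop F H R Pk * Pk * (closedLoop F H R Pk)ᵀ) := by
          rw [Matrix.mul_smul, Matrix.smul_mul]
      _ ≤ (1 - ε) ^ k • ((1 - ε) • step F H G R Pk) :=
          smul_le_smul_of_nonneg_left h1 (pow_nonneg (by linarith) _)
      _ = (1 - ε) ^ (k + 1) • (step F H G R)^[k + 1] P := by
          rw [smul_smul, ← pow_succ, Function.iterate_succ_apply']

lemma trace_le_trace (h : P ≤ P') : P.trace ≤ P'.trace := by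
  have := (Matrix.le_iff.1 h).trace_nonneg
  rw [trace_sub] at this
  linarith

lemma frobenius_norm_sq {l : Type*} [Fintype l] (X : Matrix l n ℝ) :
    ‖X‖ ^ 2 = (X * Xᵀ).trace := by
  rw [frobenius_norm_def, ← Real.sqrt_eq_rpow, Real.sq_sqrt (by positivity)]
  simp [trace, Matrix.mul_apply, sq]

/-- The closed-loop transition matrices decay exponentially, at a rate and with a constant that do
not depend on the initial covariance. -/
theorem exists_transition_bound (hR : R.PosDef) (hG : G.PosDef) {K : Matrix n m ℝ} {d : ℕ}
    (hK : (F - K * H) ^ d = 0) :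
    ∃ c θ : ℝ, 0 ≤ c ∧ 0 ≤ θ ∧ θ < 1 ∧ ∀ P : Matrix n n ℝ, P.PosSemidef → ∀ k,
      ‖transition F H G R ((step F H G R)^[d + 1] P) k‖ ≤ c * θ ^ k := by
  obtain ⟨B, hB, hBle⟩ := exists_iterate_le (F := F) (H := H) hR hG.posSemidef hK
  obtain ⟨ε, hε0, hε1, hεB⟩ := exists_smul_le hG hB
  obtain ⟨g, hg, hgG⟩ := exists_smul_one_le hG
  refine ⟨√(B.trace / g), √(1 - ε), Real.sqrt_nonneg _, Real.sqrt_nonneg _, ?_,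
    fun P hP k => ?_⟩
  · rw [Real.sqrt_lt' one_pos]; linarith
  have hB0 := hB.trace_nonneg
  have hstart := iterate_posSemidef (F := F) (H := H) hR hG.posSemidef hP (d + 1)
  -- `d` steps bring the covariance below `B`, and one step brings it above `G`
  have hup : ∀ k, (step F H G R)^[k] ((step F H G R)^[d + 1] P) ≤ B := fun k => by
    rw [← Function.iterate_add_apply, show k + (d + 1) = (k + 1) + d by ring]
    exact hBle P hP _
  have hlow : g • (1 : Matrix n n ℝ) ≤ (step F H G R)^[d + 1] P := by
    rw [Function.iterate_succ_apply']
    exact hgG.trans (le_step hR (iterate_posSemidef hR hG.posSemidef hP d))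
  have hdec := transition_conj_le (F := F) (H := H) hR hG.posSemidef hstart hε1
    (fun k => (smul_le_smul_of_nonneg_left (hup k) hε0.le).trans hεB) k
  set Φ := transition F H G R ((step F H G R)^[d + 1] P) k
  have h1 : g * ‖Φ‖ ^ 2 ≤ (1 - ε) ^ k * B.trace := by
    have h2 := trace_le_trace ((conj_le_conj hlow Φ).trans (hdec.trans
      (smul_le_smul_of_nonneg_left (hup k) (pow_nonneg (by linarith) _))))
    rw [Matrix.mul_smul, Matrix.mul_one, Matrix.smul_mul, trace_smul, trace_smul,
      ← frobenius_norm_sq] at h2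
    simpa using h2
  refine abs_le_of_sq_le_sq' ?_ (by positivity) |>.2
  rw [mul_pow, ← pow_mul, mul_comm k 2, pow_mul, Real.sq_sqrt (by positivity),
    Real.sq_sqrt (by linarith), div_mul_eq_mul_div, le_div_iff₀ hg]
  linarith

/-- Two orbits of the Riccati map differ by the initial difference, transported by the two
transition matrices. -/
lemma iterate_sub_iterate (hR : R.PosDef) (hG : G.PosSemidef) (hP : P.PosSemidef)
    (hP' : P'.PosSemidef) (k : ℕ) :
    (step F H G R)^[k] P - (step F H G R)^[k] P' =
      transition F H G R P k * (P - P') * (transition F H G R P' k)ᵀ := by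
  induction k with
  | zero => simp [transition]
  | succ k ih =>
    rw [Function.iterate_succ_apply', Function.iterate_succ_apply',
      step_sub_step hR hG (iterate_posSemidef hR hG hP k) (iterate_posSemidef hR hG hP' k), ih,
      transition, transition, transpose_mul]
    simp only [Matrix.mul_assoc]

lemma norm_mul_mul_transpose_le {l l' : Type*} [Fintype l] [Fintype l'] (X : Matrix l n ℝ)
    (D : Matrix n n ℝ) (Y : Matrix l' n ℝ) : ‖X * D * Yᵀ‖ ≤ ‖X‖ * ‖D‖ * ‖Y‖ := by
  refine (frobenius_norm_mul _ _).trans ?_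
  rw [frobenius_norm_transpose]
  gcongr
  exact frobenius_norm_mul _ _

lemma tendsto_inv {ι : Type*} {l : Filter ι} {u : ι → Matrix m m ℝ} {S : Matrix m m ℝ}
    (hS : IsUnit S.det) (hu : Tendsto u l (𝓝 S)) : Tendsto (fun i => (u i)⁻¹) l (𝓝 S⁻¹) := by
  have hdet : Tendsto (fun i => (u i).det) l (𝓝 S.det) :=
    ((continuous_id.matrix_det).tendsto S).comp hu
  have hadj : Tendsto (fun i => (u i).adjugate) l (𝓝 S.adjugate) :=
    ((continuous_id.matrix_adjugate).tendsto S).comp hu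
  simp only [Matrix.inv_def, Ring.inverse_eq_inv']
  exact (hdet.inv₀ hS.ne_zero).smul hadj

lemma tendsto_matrix_mul {ι a b c : Type*} [Fintype b] {l : Filter ι} {u : ι → Matrix a b ℝ}
    {v : ι → Matrix b c ℝ} {X : Matrix a b ℝ} {Y : Matrix b c ℝ} (hu : Tendsto u l (𝓝 X))
    (hv : Tendsto v l (𝓝 Y)) : Tendsto (fun i => u i * v i) l (𝓝 (X * Y)) :=
  ((continuous_fst.matrix_mul continuous_snd).tendsto (X, Y)).comp (hu.prodMk_nhds hv)

lemma tendsto_innovation_inv {ι : Type*} {l : Filter ι} {u : ι → Matrix n n ℝ} (hR : R.PosDef)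
    (hP : P.PosSemidef) (hu : Tendsto u l (𝓝 P)) :
    Tendsto (fun i => (H * u i * Hᵀ + R)⁻¹) l (𝓝 (H * P * Hᵀ + R)⁻¹) :=
  tendsto_inv (isUnit_det_innovation hR hP)
    ((tendsto_matrix_mul (tendsto_matrix_mul tendsto_const_nhds hu) tendsto_const_nhds).add_const R)

lemma tendsto_gain {ι : Type*} {l : Filter ι} {u : ι → Matrix n n ℝ} (hR : R.PosDef)
    (hP : P.PosSemidef) (hu : Tendsto u l (𝓝 P)) :
    Tendsto (fun i => gain H R (u i)) l (𝓝 (gain H R P)) :=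
  tendsto_matrix_mul (tendsto_matrix_mul hu tendsto_const_nhds) (tendsto_innovation_inv hR hP hu)

lemma tendsto_one_sub_gain_mul {ι : Type*} {l : Filter ι} {u : ι → Matrix n n ℝ} (hR : R.PosDef)
    (hP : P.PosSemidef) (hu : Tendsto u l (𝓝 P)) :
    Tendsto (fun i => (1 - gain H R (u i) * H) * u i) l (𝓝 ((1 - gain H R P * H) * P)) :=
  tendsto_matrix_mul
    ((tendsto_matrix_mul (tendsto_gain hR hP hu) tendsto_const_nhds).const_sub 1) hu

lemma tendsto_step {ι : Type*} {l : Filter ι} {u : ι → Matrix n n ℝ} (hR : R.PosDef)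
    (hP : P.PosSemidef) (hu : Tendsto u l (𝓝 P)) :
    Tendsto (fun i => step F H G R (u i)) l (𝓝 (step F H G R P)) :=
  (tendsto_matrix_mul (tendsto_matrix_mul tendsto_const_nhds (tendsto_one_sub_gain_mul hR hP hu))
    tendsto_const_nhds).add_const G

lemma posSemidef_of_tendsto {u : ℕ → Matrix n n ℝ} (hu : ∀ k, (u k).PosSemidef)
    (h : Tendsto u atTop (𝓝 P)) : P.PosSemidef := by
  refine PosSemidef.of_dotProduct_mulVec_nonneg ?_ fun x => ?_
  · have h1 : Tendsto (fun k => (u k)ᴴ) atTop (𝓝 Pᴴ) :=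
      ((continuous_id.matrix_conjTranspose).tendsto P).comp h
    simp only [(hu _).isHermitian.eq] at h1
    exact tendsto_nhds_unique h1 h
  · have h1 : Continuous fun X : Matrix n n ℝ => star x ⬝ᵥ (X *ᵥ x) := by fun_prop
    exact ge_of_tendsto' ((h1.tendsto P).comp h) fun k => (hu k).dotProduct_mulVec_nonneg x

/-- The Riccati map has a positive semidefinite fixed point. -/
theorem exists_fixedPoint (hR : R.PosDef) (hG : G.PosDef) {K : Matrix n m ℝ} {d : ℕ}
    (hK : (F - K * H) ^ d = 0) : ∃ P : Matrix n n ℝ, P.PosSemidef ∧ step F H G R P = P := by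
  obtain ⟨c, θ, hc, hθ0, hθ1, hbd⟩ := exists_transition_bound (F := F) (H := H) hR hG hK
  set S := step F H G R with hS
  set P₀ := S^[d + 1] 0
  have hz : (0 : Matrix n n ℝ).PosSemidef := PosSemidef.zero
  have hP₀ : P₀.PosSemidef := iterate_posSemidef hR hG.posSemidef hz _
  have hS0 : S P₀ = S^[d + 1] (S 0) := by
    rw [← Function.iterate_succ_apply' S, ← Function.iterate_succ_apply]
  have hstep : ∀ k, dist (S^[k] P₀) (S^[k + 1] P₀) ≤ (c * ‖P₀ - S P₀‖ * c) * (θ ^ 2) ^ k := by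
    intro k
    rw [Function.iterate_succ_apply, dist_eq_norm,
      iterate_sub_iterate hR hG.posSemidef hP₀ (step_posSemidef hR hG.posSemidef hP₀)]
    refine (norm_mul_mul_transpose_le _ _ _).trans ?_
    have h1 := hbd 0 hz k
    have h2 := hbd (S 0) (step_posSemidef hR hG.posSemidef hz) k
    rw [← hS0] at h2
    calc _ ≤ (c * θ ^ k) * ‖P₀ - S P₀‖ * (c * θ ^ k) := by gcongr
      _ = _ := by ring
  obtain ⟨P, hP⟩ := cauchySeq_tendsto_of_complete
    (cauchySeq_of_le_geometric _ _ (by nlinarith) hstep)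
  have hPp : P.PosSemidef :=
    posSemidef_of_tendsto (fun k => iterate_posSemidef hR hG.posSemidef hP₀ k) hP
  refine ⟨P, hPp, tendsto_nhds_unique (tendsto_step hR hPp hP) ?_⟩
  refine ((tendsto_add_atTop_iff_nat 1).2 hP).congr fun k => ?_
  rw [Function.iterate_succ_apply']

lemma transition_eq_pow (hfix : step F H G R P = P) (k : ℕ) :
    transition F H G R P k = closedLoop F H R P ^ k := by
  induction k with
  | zero => simp [transition]
  | succ k ih => rw [transition, ih, Function.iterate_fixed hfix, pow_succ']

lemma exists_closedLoop_pow_bound (hR : R.PosDef) (hG : G.PosDef) {K : Matrix n m ℝ} {d : ℕ}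
    (hK : (F - K * H) ^ d = 0) (hP : P.PosSemidef) (hfix : step F H G R P = P) :
    ∃ c θ : ℝ, 0 ≤ c ∧ 0 ≤ θ ∧ θ < 1 ∧ ∀ k, ‖closedLoop F H R P ^ k‖ ≤ c * θ ^ k := by
  obtain ⟨c, θ, hc, hθ0, hθ1, hbd⟩ := exists_transition_bound (F := F) (H := H) hR hG hK
  refine ⟨c, θ, hc, hθ0, hθ1, fun k => ?_⟩
  have := hbd P hP k
  rwa [Function.iterate_fixed hfix, transition_eq_pow hfix] at this

/-- Every orbit of the Riccati map converges to any given positive semidefinite fixed point. -/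
theorem tendsto_iterate (hR : R.PosDef) (hG : G.PosDef) {K : Matrix n m ℝ} {d : ℕ}
    (hK : (F - K * H) ^ d = 0) (hP : P.PosSemidef) (hfix : step F H G R P = P)
    (hP' : P'.PosSemidef) : Tendsto (fun k => (step F H G R)^[k] P') atTop (𝓝 P) := by
  obtain ⟨c, θ, hc, hθ0, hθ1, hbd⟩ := exists_transition_bound (F := F) (H := H) hR hG hK
  rw [← tendsto_add_atTop_iff_nat (d + 1)]
  refine tendsto_iff_norm_sub_tendsto_zero.2 ?_
  set P₀ := (step F H G R)^[d + 1] P' with hP₀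
  have hlim : Tendsto (fun k => (c * ‖P₀ - P‖ * c) * (θ ^ 2) ^ k) atTop (𝓝 0) := by
    simpa using (tendsto_pow_atTop_nhds_zero_of_lt_one (by positivity)
      (by nlinarith : θ ^ 2 < 1)).const_mul (c * ‖P₀ - P‖ * c)
  refine squeeze_zero (fun _ => norm_nonneg _) (fun k => ?_) hlim
  have h1 := hbd P' hP' k
  have h2 := hbd P hP k
  rw [Function.iterate_fixed hfix] at h2
  have h3 := iterate_sub_iterate (F := F) (H := H) hR hG.posSemidef
    (iterate_posSemidef (F := F) (H := H) hR hG.posSemidef hP' (d + 1)) hP k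
  rw [Function.iterate_fixed hfix, ← Function.iterate_add_apply] at h3
  rw [h3]
  refine (norm_mul_mul_transpose_le _ _ _).trans ?_
  calc _ ≤ (c * θ ^ k) * ‖P₀ - P‖ * (c * θ ^ k) := by gcongr
    _ = _ := by ring

end Riccati

/-! ### Stability and the cross-covariance -/

namespace Riccati

section Stable

attribute [local instance] Matrix.frobeniusNormedRing Matrix.frobeniusNormedAlgebra

lemma isSchurStable_of_tendsto_pow {n : Type*} [Fintype n] [DecidableEq n] {X : Matrix n n ℝ}
    (h : Tendsto (fun k => X ^ k) atTop (𝓝 0)) : IsSchurStable X := by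
  intro μ hμ
  set f := (algebraMap ℝ ℂ).mapMatrix (m := n) with hf
  have hf0 : Tendsto (fun k => f X ^ k) atTop (𝓝 0) := by
    have h1 : Continuous fun Y : Matrix n n ℝ => Y.map (algebraMap ℝ ℂ) :=
      continuous_id.matrix_map (continuous_algebraMap ℝ ℂ)
    have h2 := (h1.tendsto 0).comp h
    rw [Matrix.map_zero _ (map_zero _)] at h2
    refine h2.congr fun k => ?_
    rw [← map_pow]
    rfl
  have hb : ∀ k, ‖μ‖ ^ k ≤ ‖f X ^ k‖ * ‖(1 : Matrix n n ℂ)‖ := fun k => by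
    rw [← norm_pow]
    exact spectrum.norm_le_norm_mul_of_mem (spectrum.pow_mem_pow (f X) k hμ)
  have hlim : Tendsto (fun k => ‖μ‖ ^ k) atTop (𝓝 0) :=
    squeeze_zero (fun k => by positivity) hb (by
      simpa using (tendsto_zero_iff_norm_tendsto_zero.1 hf0).mul_const ‖(1 : Matrix n n ℂ)‖)
  simpa using tendsto_pow_atTop_nhds_zero_iff.1 hlim

end Stable

attribute [local instance] Matrix.frobeniusNormedAddCommGroup Matrix.frobeniusNormedSpace

lemma norm_le_of_norm_sub_le {E : Type*} [SeminormedAddCommGroup E] {a : ℕ → E} {c : ℝ} {j : ℕ}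
    (hc : 0 ≤ c) (h : ∀ k, ‖a (k + 1) - a k‖ ≤ c * (k + 1) ^ j) (k : ℕ) :
    ‖a k‖ ≤ (‖a 0‖ + c) * (k + 1) ^ (j + 1) := by
  induction k with
  | zero => simpa using hc
  | succ k ih =>
    have h1 : ‖a (k + 1)‖ ≤ ‖a k‖ + ‖a (k + 1) - a k‖ := by
      simpa using norm_add_le (a k) (a (k + 1) - a k)
    have h2 : ((k : ℝ) + 1) ^ (j + 1) + (k + 1) ^ j ≤ ((k + 1 : ℕ) + 1) ^ (j + 1) := by
      calc ((k : ℝ) + 1) ^ (j + 1) + (k + 1) ^ j = (k + 1) ^ j * (k + 1 + 1) := by ring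
        _ ≤ (k + 1 + 1) ^ j * (k + 1 + 1) := by gcongr; linarith
        _ = _ := by push_cast; ring
    have h3 : c * ((k : ℝ) + 1) ^ j ≤ (‖a 0‖ + c) * (k + 1) ^ j := by
      gcongr
      linarith [norm_nonneg (a 0)]
    calc ‖a (k + 1)‖ ≤ (‖a 0‖ + c) * (k + 1) ^ (j + 1) + (‖a 0‖ + c) * (k + 1) ^ j := by
          linarith [h k]
      _ ≤ _ := by
          rw [← mul_add]
          gcongr

variable {p q : Type*} [Fintype p] [DecidableEq p] [Fintype q]

/-- A recursion driven by a unipotent matrix of nilpotency index two and a bounded input grows at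
most quadratically. -/
lemma exists_quadratic_bound {A : Matrix p p ℝ} (hA : (A - 1) * (A - 1) = 0)
    {Y E : ℕ → Matrix p q ℝ} {e : ℝ} (hE : ∀ k, ‖E k‖ ≤ e)
    (hY : ∀ k, Y (k + 1) = A * Y k + E k) : ∃ C : ℝ, ∀ k : ℕ, ‖Y k‖ ≤ C * (k + 1) ^ 2 := by
  have he : 0 ≤ e := (norm_nonneg _).trans (hE 0)
  have h1 : ∀ k : ℕ, ‖(A - 1) * Y k‖ ≤ (‖(A - 1) * Y 0‖ + ‖A - 1‖ * e) * (k + 1) ^ (0 + 1) := by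
    refine norm_le_of_norm_sub_le (by positivity) fun k => ?_
    have : (A - 1) * Y (k + 1) - (A - 1) * Y k = (A - 1) * E k := by
      calc _ = (A - 1) * (A - 1) * Y k + (A - 1) * E k := by
            rw [hY]
            simp only [Matrix.mul_add, Matrix.sub_mul, Matrix.mul_sub, Matrix.mul_assoc,
              Matrix.one_mul]
            abel
        _ = _ := by rw [hA, Matrix.zero_mul, zero_add]
    rw [this, pow_zero, mul_one]
    exact (frobenius_norm_mul _ _).trans (by gcongr; exact hE k)
  refine ⟨_, norm_le_of_norm_sub_le (c := ‖(A - 1) * Y 0‖ + ‖A - 1‖ * e + e) (j := 1)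
    (by positivity) fun k => ?_⟩
  have h2 : Y (k + 1) - Y k = (A - 1) * Y k + E k := by
    rw [hY, Matrix.sub_mul, Matrix.one_mul]
    abel
  rw [h2]
  refine (norm_add_le _ _).trans ((add_le_add (h1 k) (hE k)).trans ?_)
  have : e ≤ e * ((k : ℝ) + 1) :=
    le_mul_of_one_le_right he (by linarith [Nat.cast_nonneg (α := ℝ) k])
  simp only [zero_add, pow_one]
  linarith

lemma tendsto_mul_transpose_of_bounds {r : Type*} [Fintype r] {Y : ℕ → Matrix p q ℝ}
    {Φ : ℕ → Matrix r q ℝ} {C c θ : ℝ} (hY : ∀ k : ℕ, ‖Y k‖ ≤ C * (k + 1) ^ 2) (hθ0 : 0 ≤ θ)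
    (hθ1 : θ < 1) (hΦ : ∀ k, ‖Φ k‖ ≤ c * θ ^ k) :
    Tendsto (fun k => Y k * (Φ k)ᵀ) atTop (𝓝 0) := by
  have hC : 0 ≤ C := (norm_nonneg _).trans (by simpa using hY 0)
  have hc : 0 ≤ c := (norm_nonneg _).trans (by simpa using hΦ 0)
  refine squeeze_zero_norm (a := fun k : ℕ => 2 * C * c * ((k : ℝ) ^ 2 * θ ^ k + θ ^ k))
    (fun k => ?_) ?_
  · refine (frobenius_norm_mul _ _).trans ?_
    rw [frobenius_norm_transpose]
    calc ‖Y k‖ * ‖Φ k‖ ≤ (C * (k + 1) ^ 2) * (c * θ ^ k) := by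
          gcongr
          exacts [hY k, hΦ k]
      _ = C * c * θ ^ k * (k + 1) ^ 2 := by ring
      _ ≤ C * c * θ ^ k * (2 * k ^ 2 + 2) := by
          gcongr
          nlinarith [sq_nonneg ((k : ℝ) - 1)]
      _ = _ := by ring
  · have h1 := tendsto_pow_const_mul_const_pow_of_lt_one 2 hθ0 hθ1
    have h2 := tendsto_pow_atTop_nhds_zero_of_lt_one hθ0 hθ1
    simpa using (h1.add h2).const_mul (2 * C * c)

variable {m n : Type*} [Fintype m] [DecidableEq m] [Fintype n] [DecidableEq n]

lemma tendsto_pow_mul_mul_pow_transpose {A : Matrix p p ℝ} (hA : (A - 1) * (A - 1) = 0)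
    {Γ : Matrix n n ℝ} {c θ : ℝ} (hθ0 : 0 ≤ θ) (hθ1 : θ < 1) (hΓ : ∀ k, ‖Γ ^ k‖ ≤ c * θ ^ k)
    (X : Matrix p n ℝ) : Tendsto (fun k => A ^ k * X * (Γ ^ k)ᵀ) atTop (𝓝 0) := by
  obtain ⟨C, hC⟩ := exists_quadratic_bound (Y := fun k => A ^ k * X) (E := fun _ => 0) (e := 0) hA
    (by simp) (fun k => by rw [pow_succ', Matrix.mul_assoc, add_zero])
  exact tendsto_mul_transpose_of_bounds hC hθ0 hθ1 hΓ

lemma tendsto_kronecker_pow {A : Matrix p p ℝ} (hA : (A - 1) * (A - 1) = 0)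
    {Γ : Matrix n n ℝ} {c θ : ℝ} (hθ0 : 0 ≤ θ) (hθ1 : θ < 1) (hΓ : ∀ k, ‖Γ ^ k‖ ≤ c * θ ^ k) :
    Tendsto (fun k => (Γ ⊗ₖ A) ^ k) atTop (𝓝 0) := by
  have hpow : ∀ k : ℕ, (Γ ⊗ₖ A) ^ k = (Γ ^ k) ⊗ₖ (A ^ k) := fun k => by
    induction k with
    | zero => simp
    | succ k ih => rw [pow_succ, ih, ← mul_kronecker_mul, pow_succ, pow_succ]
  simp only [hpow]
  refine tendsto_pi_nhds.2 fun ⟨i, a⟩ => tendsto_pi_nhds.2 fun ⟨j, b⟩ => ?_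
  -- the entries of the Kronecker product are those of `A ^ k * E * (Γ ^ k)ᵀ` for a matrix unit `E`
  have h := tendsto_pow_mul_mul_pow_transpose hA hθ0 hθ1 hΓ (Matrix.single b j 1)
  have h1 := tendsto_pi_nhds.1 (tendsto_pi_nhds.1 h a) i
  refine h1.congr fun k => ?_
  simp [-transpose_pow, Matrix.mul_apply, Matrix.single_apply, kroneckerMap_apply, mul_comm,
    ite_and]

/-- A Stein equation `X = A X Γᵀ + Z` with decaying powers of `Γ` and polynomially growing powers
of `A` is uniquely solvable. -/
lemma existsUnique_stein {A : Matrix p p ℝ} (hA : (A - 1) * (A - 1) = 0)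
    {Γ : Matrix n n ℝ} {c θ : ℝ} (hθ0 : 0 ≤ θ) (hθ1 : θ < 1) (hΓ : ∀ k, ‖Γ ^ k‖ ≤ c * θ ^ k)
    (Z : Matrix p n ℝ) : ∃! X : Matrix p n ℝ, X = A * X * Γᵀ + Z := by
  let f : Matrix p n ℝ →ₗ[ℝ] Matrix p n ℝ :=
    { toFun := fun X => X - A * X * Γᵀ
      map_add' := fun X Y => by rw [Matrix.mul_add, Matrix.add_mul]; abel
      map_smul' := fun t X => by simp [smul_sub] }
  have hinj : Function.Injective f := by
    refine (injective_iff_map_eq_zero f).2 fun X hX => ?_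
    have hX1 : X = A * X * Γᵀ := sub_eq_zero.1 hX
    have hX2 : ∀ k : ℕ, A ^ k * X * (Γ ^ k)ᵀ = X := fun k => by
      induction k with
      | zero => simp
      | succ k ih =>
        rw [pow_succ' A, pow_succ' Γ, transpose_mul]
        conv_rhs => rw [hX1, ← ih]
        simp only [Matrix.mul_assoc]
    have h := tendsto_pow_mul_mul_pow_transpose hA hθ0 hθ1 hΓ X
    simp only [hX2] at h
    exact tendsto_nhds_unique tendsto_const_nhds h
  have hiff : ∀ X, X = A * X * Γᵀ + Z ↔ f X = Z := fun X => sub_eq_iff_eq_add'.symm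
  obtain ⟨X, hX⟩ := LinearMap.injective_iff_surjective.1 hinj Z
  exact ⟨X, (hiff X).2 hX, fun Y hY => hinj (((hiff Y).1 hY).trans hX.symm)⟩

variable {F : Matrix n n ℝ} {H : Matrix m n ℝ} {G : Matrix n n ℝ} {R : Matrix m m ℝ}
  {P P' : Matrix n n ℝ} {A : Matrix p p ℝ} {U Z X : Matrix p n ℝ}

/-- One step of the error of the cross-covariance with respect to its steady state. -/
lemma cross_sub_cross (hR : R.PosDef) (hP : P.PosSemidef) (hP' : P'.PosSemidef)
    (X X' : Matrix p n ℝ) :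
    (A * X + U * P) * (closedLoop F H R P)ᵀ - (A * X' + U * P') * (closedLoop F H R P')ᵀ =
      (A * (X - X') + (U - (A * X + U * P) * Hᵀ * (H * P * Hᵀ + R)⁻¹ * H) * (P - P')) *
        (closedLoop F H R P')ᵀ := by
  have hS : ((H * P * Hᵀ + R)⁻¹)ᵀ = (H * P * Hᵀ + R)⁻¹ :=
    transpose_eq_of_posDef (innovation_posDef (H := H) hR hP).inv
  have h1 := congrArg transpose (closedLoop_sub_closedLoop (F := F) (H := H) hR hP' hP)
  have h2 : (closedLoop F H R P)ᵀ = (closedLoop F H R P')ᵀ -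
      Hᵀ * (H * P * Hᵀ + R)⁻¹ * H * (P - P') * (closedLoop F H R P')ᵀ := by
    rw [transpose_neg, transpose_mul, transpose_mul, transpose_mul, transpose_mul, transpose_sub,
      transpose_sub, transpose_transpose, hS, transpose_eq_of_posSemidef hP,
      transpose_eq_of_posSemidef hP', ← neg_sub P P', Matrix.neg_mul] at h1
    simp only [Matrix.mul_neg, neg_neg] at h1
    rw [eq_sub_iff_add_eq, ← eq_sub_iff_add_eq']
    simpa only [Matrix.mul_assoc] using h1.symm
  rw [h2]
  set Γ := (closedLoop F H R P')ᵀ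
  simp only [Matrix.add_mul, Matrix.mul_sub, Matrix.sub_mul, Matrix.mul_assoc]
  abel

/-- The cross-covariance of the filter converges to the solution of the Stein equation. -/
theorem tendsto_cross (hR : R.PosDef) (hG : G.PosDef) {K : Matrix n m ℝ} {d : ℕ}
    (hK : (F - K * H) ^ d = 0) (hP : P.PosSemidef) (hfix : step F H G R P = P)
    (hA : (A - 1) * (A - 1) = 0) (hX : X = (A * X + U * P) * (closedLoop F H R P)ᵀ + Z)
    (hP' : P'.PosSemidef) {x : ℕ → Matrix p n ℝ}
    (hx : ∀ k, x (k + 1) = (A * x k + U * (step F H G R)^[k] P') *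
      (closedLoop F H R ((step F H G R)^[k] P'))ᵀ + Z) :
    Tendsto x atTop (𝓝 X) := by
  obtain ⟨c, θ, hc, hθ0, hθ1, hbd⟩ := exists_transition_bound (F := F) (H := H) hR hG hK
  rw [← tendsto_add_atTop_iff_nat (d + 1)]
  have hP₀ : ((step F H G R)^[d + 1] P').PosSemidef :=
    iterate_posSemidef hR hG.posSemidef hP' (d + 1)
  have hΦ := hbd P' hP'
  have hΓ : ∀ k, ‖closedLoop F H R P ^ k‖ ≤ c * θ ^ k := fun k => by
    have := hbd P hP k
    rwa [Function.iterate_fixed hfix, transition_eq_pow hfix] at this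
  have hx' : ∀ k, x (k + 1 + (d + 1)) =
      (A * x (k + (d + 1)) + U * (step F H G R)^[k] ((step F H G R)^[d + 1] P')) *
      (closedLoop F H R ((step F H G R)^[k] ((step F H G R)^[d + 1] P')))ᵀ + Z := fun k => by
    rw [add_right_comm, hx, Function.iterate_add_apply]
  generalize (step F H G R)^[d + 1] P' = P₀ at *
  set N := U - (A * X + U * P) * Hᵀ * (H * P * Hᵀ + R)⁻¹ * H with hN
  -- the error is `Y k * (Φ k)ᵀ`, where `Φ` is the decaying transition matrix and `Y` grows slowly
  let Y : ℕ → Matrix p n ℝ := fun k => Nat.rec (X - x (d + 1))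
    (fun k y => A * y + N * (closedLoop F H R P ^ k * (P - P₀))) k
  have hY : ∀ k, X - x (k + (d + 1)) = Y k * (transition F H G R P₀ k)ᵀ := fun k => by
    induction k with
    | zero => simp [transition, Y]
    | succ k ih =>
      have h1 := iterate_sub_iterate (F := F) (H := H) hR hG.posSemidef hP hP₀ k
      rw [Function.iterate_fixed hfix, transition_eq_pow hfix] at h1
      rw [hx' k]
      conv_lhs => rw [hX]
      rw [add_sub_add_right_eq_sub,
        cross_sub_cross hR hP (iterate_posSemidef hR hG.posSemidef hP₀ k), ← hN, ih, h1, transition,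
        transpose_mul]
      change _ = (A * Y k + N * (closedLoop F H R P ^ k * (P - P₀))) * _
      simp only [Matrix.add_mul, Matrix.mul_assoc]
  have hE : ∀ k, ‖N * (closedLoop F H R P ^ k * (P - P₀))‖ ≤ ‖N‖ * (c * ‖P - P₀‖) := fun k => by
    refine (frobenius_norm_mul _ _).trans ?_
    gcongr
    refine (frobenius_norm_mul _ _).trans ?_
    gcongr
    exact (hΓ k).trans (mul_le_of_le_one_right hc (pow_le_one₀ hθ0 hθ1.le))
  obtain ⟨C, hC⟩ := exists_quadratic_bound (Y := Y) hA hE fun k => rfl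
  have hlim := (tendsto_mul_transpose_of_bounds hC hθ0 hθ1 hΦ).const_sub X
  rw [sub_zero] at hlim
  refine hlim.congr fun k => ?_
  rw [← hY, sub_sub_cancel]

end Riccati

/-! ### Kronecker products with columns and rows -/

section KroneckerEntries

variable {m n : Type*}

@[simp]
lemma kronCol_apply (b : Fin 2 → ℝ) (X : Matrix m n ℝ) (a : Fin 2) (i : m) (j : n) :
    kronCol b X (a, i) j = b a * X i j := rfl

@[simp]
lemma kronRow_apply (b : Fin 2 → ℝ) (X : Matrix m n ℝ) (i : m) (a : Fin 2) (j : n) :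
    kronRow b X i (a, j) = b a * X i j := rfl

@[simp]
lemma idKronCol_apply (v : m → ℝ) (a : Fin 2) (i : m) (b : Fin 2) :
    idKronCol v (a, i) b = (1 : Matrix (Fin 2) (Fin 2) ℝ) a b * v i := rfl

@[simp]
lemma idKronRow_apply (v : m → ℝ) (a b : Fin 2) (i : m) :
    idKronRow v a (b, i) = (1 : Matrix (Fin 2) (Fin 2) ℝ) a b * v i := rfl

end KroneckerEntries

namespace MixedEnsemble

variable {c M : ℕ} (E : MixedEnsemble c M) (D : Weighting c M)

/-! ### The change of coordinates -/

lemma V_mulVec_eq_zero_iff (x : Clock c M → ℝ) : E.V *ᵥ x = 0 ↔ ∃ t : ℝ, x = fun _ => t := by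
  have h : x ∈ LinearMap.ker E.V.mulVecLin ↔ x ∈ Submodule.span ℝ {(1 : Clock c M → ℝ)} := by
    rw [E.ker_V]
  rw [LinearMap.mem_ker, Submodule.mem_span_singleton, mulVecLin_apply] at h
  rw [h]
  refine exists_congr fun t => ⟨fun h => ?_, fun h => ?_⟩ <;>
    · subst h
      funext i
      simp

lemma V_mulVec_const (t : ℝ) : E.V *ᵥ (fun _ => t) = 0 := (E.V_mulVec_eq_zero_iff _).2 ⟨t, rfl⟩

lemma q_dotProduct_W (x : Meas c M → ℝ) : D.q ⬝ᵥ (D.W *ᵥ x) = 0 := by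
  rw [dotProduct_mulVec, D.q_W, zero_dotProduct]

lemma q_dotProduct_const (t : ℝ) : D.q ⬝ᵥ (fun _ => t) = t := by
  simp [dotProduct, ← Finset.sum_mul, D.q_sum]

lemma isUnit_det_V_mul_W : IsUnit (E.V * D.W).det := by
  rw [← Matrix.isUnit_iff_isUnit_det, ← Matrix.mulVec_injective_iff_isUnit]
  have hW : Function.Injective D.W.mulVec := by
    rw [Matrix.mulVec_injective_iff, linearIndependent_iff_card_eq_finrank_span,
      Fintype.card_fin, ← D.W_rank, Matrix.rank_eq_finrank_span_cols, Set.finrank]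
  refine (injective_iff_map_eq_zero (E.V * D.W).mulVecLin).2 fun x hx => ?_
  rw [mulVecLin_apply, ← mulVec_mulVec] at hx
  obtain ⟨t, ht⟩ := (E.V_mulVec_eq_zero_iff _).1 hx
  have h0 := q_dotProduct_W D x
  rw [ht, q_dotProduct_const] at h0
  refine hW ?_
  rw [ht, h0, mulVec_zero]
  rfl

lemma V_mul_Vplus : E.V * E.Vplus D = 1 := by
  rw [Vplus, ← Matrix.mul_assoc, Matrix.mul_nonsing_inv _ (E.isUnit_det_V_mul_W D)]

lemma q_vecMul_Vplus : D.q ᵥ* E.Vplus D = 0 := by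
  rw [Vplus, ← vecMul_vecMul, D.q_W, zero_vecMul]

end MixedEnsemble

namespace MixedEnsemble

variable {c M : ℕ} (E : MixedEnsemble c M) (D : Weighting c M)

/-! ### Nondegeneracy of the process noise -/

lemma Qx_apply (a b : Fin 2) (i j : Clock c M) : E.Qx (a, i) (b, j) =
    (!![E.τ • E.Sig1 + (E.τ ^ 3 / 3) • E.Sig2 + (E.τ ^ 5 / 20) • E.Sig3,
        (E.τ ^ 2 / 2) • E.Sig2 + (E.τ ^ 4 / 8) • E.Sig3;
      (E.τ ^ 2 / 2) • E.Sig2 + (E.τ ^ 4 / 8) • E.Sig3,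
        E.τ • E.Sig2 + (E.τ ^ 3 / 3) • E.Sig3] :
      Matrix (Fin 2) (Fin 2) (Matrix (Clock c M) (Clock c M) ℝ)) a b i j := rfl

lemma Q_isHermitian : E.Q.IsHermitian := by
  have hx : E.Qx.IsHermitian := by
    ext ⟨a, i⟩ ⟨b, j⟩
    have h1 : E.Sig1 j i = E.Sig1 i j := congrFun₂ (diagonal_transpose fun i => E.σ₁ i ^ 2) i j
    have h2 : E.Sig2 j i = E.Sig2 i j := congrFun₂ (diagonal_transpose fun i => E.σ₂ i ^ 2) i j
    have h3 : E.Sig3 j i = E.Sig3 i j := congrFun₂ (diagonal_transpose _) i j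
    fin_cases a <;> fin_cases b <;> simp [Qx_apply, h1, h2, h3]
  rw [Q, isHermitian_fromBlocks_iff]
  refine ⟨hx, by simp, by simp, ?_⟩
  rw [IsHermitian, conjTranspose_eq_transpose_of_trivial, transpose_smul, Sig5, diagonal_transpose]

/-- The quadratic form of the process noise covariance as a sum of squares: one block for each
cesium clock, and one for each maser together with its drift. -/
lemma dotProduct_Q_mulVec (x : StateIx c M → ℝ) : x ⬝ᵥ (E.Q *ᵥ x) =
    ∑ i : Fin c, (E.τ * (E.σ₁ (Sum.inl i) * x (Sum.inl (0, Sum.inl i))) ^ 2 +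
      E.τ * E.σ₂ (Sum.inl i) ^ 2 *
        ((x (Sum.inl (1, Sum.inl i)) + E.τ / 2 * x (Sum.inl (0, Sum.inl i))) ^ 2 +
          E.τ ^ 2 / 12 * x (Sum.inl (0, Sum.inl i)) ^ 2)) +
    ∑ j : Fin M, (E.τ * (E.σ₁ (Sum.inr j) * x (Sum.inl (0, Sum.inr j))) ^ 2 +
      E.τ * E.σ₂ (Sum.inr j) ^ 2 *
        ((x (Sum.inl (1, Sum.inr j)) + E.τ / 2 * x (Sum.inl (0, Sum.inr j))) ^ 2 +
          E.τ ^ 2 / 12 * x (Sum.inl (0, Sum.inr j)) ^ 2) +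
      E.τ * E.σ₃ j ^ 2 *
        ((x (Sum.inr j) + E.τ / 2 * x (Sum.inl (1, Sum.inr j)) +
            E.τ ^ 2 / 6 * x (Sum.inl (0, Sum.inr j))) ^ 2 +
          E.τ ^ 2 / 12 * (x (Sum.inl (1, Sum.inr j)) + E.τ / 2 * x (Sum.inl (0, Sum.inr j))) ^ 2 +
          E.τ ^ 4 / 720 * x (Sum.inl (0, Sum.inr j)) ^ 2)) := by
  have hpc : ∀ i : Fin c, (E.Q *ᵥ x) (Sum.inl (0, Sum.inl i)) =
      (E.τ * E.σ₁ (Sum.inl i) ^ 2 + E.τ ^ 3 / 3 * E.σ₂ (Sum.inl i) ^ 2) *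
        x (Sum.inl (0, Sum.inl i)) +
      E.τ ^ 2 / 2 * E.σ₂ (Sum.inl i) ^ 2 * x (Sum.inl (1, Sum.inl i)) := fun i => by
    simp [Q, Qx_apply, Qxz, Sig1, Sig2, Sig3, Sig4, mulVec, dotProduct, Fintype.sum_prod_type,
      diagonal_apply, add_mul, Finset.sum_add_distrib]
  have hfc : ∀ i : Fin c, (E.Q *ᵥ x) (Sum.inl (1, Sum.inl i)) =
      E.τ ^ 2 / 2 * E.σ₂ (Sum.inl i) ^ 2 * x (Sum.inl (0, Sum.inl i)) +
      E.τ * E.σ₂ (Sum.inl i) ^ 2 * x (Sum.inl (1, Sum.inl i)) := fun i => by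
    simp [Q, Qx_apply, Qxz, Sig2, Sig3, Sig4, mulVec, dotProduct, Fintype.sum_prod_type,
      diagonal_apply, Finset.sum_add_distrib]
  have hpm : ∀ j : Fin M, (E.Q *ᵥ x) (Sum.inl (0, Sum.inr j)) =
      (E.τ * E.σ₁ (Sum.inr j) ^ 2 + E.τ ^ 3 / 3 * E.σ₂ (Sum.inr j) ^ 2 +
        E.τ ^ 5 / 20 * E.σ₃ j ^ 2) * x (Sum.inl (0, Sum.inr j)) +
      (E.τ ^ 2 / 2 * E.σ₂ (Sum.inr j) ^ 2 + E.τ ^ 4 / 8 * E.σ₃ j ^ 2) *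
        x (Sum.inl (1, Sum.inr j)) +
      E.τ ^ 3 / 6 * E.σ₃ j ^ 2 * x (Sum.inr j) := fun j => by
    simp [Q, Qx_apply, Qxz, Sig1, Sig2, Sig3, Sig4, mulVec, dotProduct, Fintype.sum_prod_type,
      diagonal_apply, add_mul, Finset.sum_add_distrib]
  have hfm : ∀ j : Fin M, (E.Q *ᵥ x) (Sum.inl (1, Sum.inr j)) =
      (E.τ ^ 2 / 2 * E.σ₂ (Sum.inr j) ^ 2 + E.τ ^ 4 / 8 * E.σ₃ j ^ 2) *
        x (Sum.inl (0, Sum.inr j)) +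
      (E.τ * E.σ₂ (Sum.inr j) ^ 2 + E.τ ^ 3 / 3 * E.σ₃ j ^ 2) * x (Sum.inl (1, Sum.inr j)) +
      E.τ ^ 2 / 2 * E.σ₃ j ^ 2 * x (Sum.inr j) := fun j => by
    simp [Q, Qx_apply, Qxz, Sig2, Sig3, Sig4, mulVec, dotProduct, Fintype.sum_prod_type,
      diagonal_apply, add_mul, Finset.sum_add_distrib]
  have hz : ∀ j : Fin M, (E.Q *ᵥ x) (Sum.inr j) =
      E.τ ^ 3 / 6 * E.σ₃ j ^ 2 * x (Sum.inl (0, Sum.inr j)) +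
      E.τ ^ 2 / 2 * E.σ₃ j ^ 2 * x (Sum.inl (1, Sum.inr j)) +
      E.τ * E.σ₃ j ^ 2 * x (Sum.inr j) := fun j => by
    simp [Q, Qxz, Sig4, Sig5, mulVec, dotProduct, Fintype.sum_prod_type, diagonal_apply]
  simp only [dotProduct, Fintype.sum_sum_type, Fintype.sum_prod_type, Fin.sum_univ_two, hpc, hfc,
    hpm, hfm, hz]
  rw [add_add_add_comm, add_assoc, ← Finset.sum_add_distrib, ← Finset.sum_add_distrib,
    ← Finset.sum_add_distrib]
  congr 1 <;> refine Finset.sum_congr rfl fun i _ => ?_ <;> ring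

/-- The noise of highest order of each clock makes the whole process noise nondegenerate. -/
lemma Q_posDef : E.Q.PosDef := by
  refine PosDef.of_dotProduct_mulVec_pos E.Q_isHermitian fun x hx => ?_
  rw [star_trivial, E.dotProduct_Q_mulVec x]
  have hτ := E.τ_pos
  refine lt_of_le_of_ne (by positivity) fun h0 => hx ?_
  have h1 := (add_eq_zero_iff_of_nonneg (by positivity) (by positivity)).1 h0.symm
  rw [Finset.sum_eq_zero_iff_of_nonneg (fun i _ => by positivity),
    Finset.sum_eq_zero_iff_of_nonneg (fun i _ => by positivity)] at h1
  obtain ⟨hc, hm⟩ := h1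
  have hcs : ∀ i : Fin c, x (Sum.inl (0, Sum.inl i)) = 0 ∧ x (Sum.inl (1, Sum.inl i)) = 0 := by
    intro i
    have hσ := E.σ₂_cesium_pos i
    have h2 := ((add_eq_zero_iff_of_nonneg (by positivity) (by positivity)).1
      (hc i (Finset.mem_univ i))).2
    have h3 := (add_eq_zero_iff_of_nonneg (by positivity) (by positivity)).1
      ((mul_eq_zero.1 h2).resolve_left (by positivity))
    have h4 : x (Sum.inl (0, Sum.inl i)) = 0 := by
      simpa using (mul_eq_zero.1 h3.2).resolve_left (by positivity)
    exact ⟨h4, by simpa [h4] using h3.1⟩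
  have hms : ∀ j : Fin M, x (Sum.inl (0, Sum.inr j)) = 0 ∧ x (Sum.inl (1, Sum.inr j)) = 0 ∧
      x (Sum.inr j) = 0 := by
    intro j
    have hσ := E.σ₃_pos j
    have h2 := ((add_eq_zero_iff_of_nonneg (by positivity) (by positivity)).1
      (hm j (Finset.mem_univ j))).2
    have h3 := (add_eq_zero_iff_of_nonneg (by positivity) (by positivity)).1
      ((mul_eq_zero.1 h2).resolve_left (by positivity))
    have h4 : x (Sum.inl (0, Sum.inr j)) = 0 := by
      simpa using (mul_eq_zero.1 h3.2).resolve_left (by positivity)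
    have h5 := (add_eq_zero_iff_of_nonneg (by positivity) (by positivity)).1 h3.1
    have h6 : x (Sum.inl (1, Sum.inr j)) = 0 := by
      simpa [h4] using (mul_eq_zero.1 h5.2).resolve_left (by positivity)
    exact ⟨h4, h6, by simpa [h4, h6] using h5.1⟩
  funext k
  rcases k with ⟨a, i | j⟩ | j
  · fin_cases a
    exacts [(hcs i).1, (hcs i).2]
  · fin_cases a
    exacts [(hms j).1, (hms j).2.1]
  · exact (hms j).2.2

lemma To_mul_rightInverse :
    E.To * (fromBlocks ((1 : Matrix (Fin 2) (Fin 2) ℝ) ⊗ₖ E.Vplus D) 0 0 1 :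
      Matrix (StateIx c M) (ObsIx c M) ℝ) = 1 := by
  simp [To, fromBlocks_multiply, ← mul_kronecker_mul, V_mul_Vplus]

lemma To_mul_Q_mul_To_posDef (D : Weighting c M) : (E.To * E.Q * E.Toᵀ).PosDef := by
  have hinj : Function.Injective E.To.vecMul := fun x y hxy => by
    have h := congrArg (· ᵥ* (fromBlocks ((1 : Matrix (Fin 2) (Fin 2) ℝ) ⊗ₖ E.Vplus D) 0 0 1 :
      Matrix (StateIx c M) (ObsIx c M) ℝ)) hxy
    simpa [vecMul_vecMul, To_mul_rightInverse] using h
  simpa using E.Q_posDef.mul_mul_conjTranspose_same hinj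

/-! ### A deadbeat observer gain -/

lemma V_mul_J_injective : Function.Injective (E.V * E.J).mulVec := by
  refine (injective_iff_map_eq_zero (E.V * E.J).mulVecLin).2 fun z hz => ?_
  rw [mulVecLin_apply, ← mulVec_mulVec] at hz
  obtain ⟨t, ht⟩ := (E.V_mulVec_eq_zero_iff _).1 hz
  rw [J, fromRows_mulVec, zero_mulVec, one_mulVec] at ht
  -- a cesium clock forces the constant to vanish
  have h0 : 0 = t := congrFun ht (Sum.inl ⟨0, E.cesium_pos⟩)
  funext j
  have h1 : z j = t := congrFun ht (Sum.inr j)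
  rw [h1, ← h0, Pi.zero_apply]

lemma exists_leftInverse_V_mul_J : ∃ S : Matrix (Fin M) (Meas c M) ℝ, S * (E.V * E.J) = 1 := by
  obtain ⟨g, hg⟩ := (E.V * E.J).mulVecLin.exists_leftInverse_of_injective
    (LinearMap.ker_eq_bot.2 E.V_mul_J_injective)
  refine ⟨LinearMap.toMatrix' g, ?_⟩
  rw [← LinearMap.toMatrix'_id, ← hg, LinearMap.toMatrix'_comp, ← Matrix.toLin'_apply',
    LinearMap.toMatrix'_toLin']

/-- Two integrators measured at the first one, and three on the range of `t`, are brought to rest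
in three steps by constant gains. -/
lemma deadbeat_integrators {X Z : Type*} [AddCommGroup X] [Module ℝ X] [AddCommGroup Z] [Module ℝ Z]
    {t : Z →ₗ[ℝ] X} {s : X →ₗ[ℝ] Z} (hst : ∀ z, s (t z) = z) {τ : ℝ} (hτ : τ ≠ 0)
    {φ : X × X × Z → X × X × Z} (hφ : ∀ p f z, φ (p, f, z) =
      (-p - t (s p) + τ • f + (τ ^ 2 / 2) • t z,
        f + τ • t z - (1 / τ) • (p + (3 / 2 : ℝ) • t (s p)),
        z - (1 / τ ^ 2) • s p)) (x : X × X × Z) : φ (φ (φ x)) = 0 := by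
  obtain ⟨p, f, z⟩ := x
  rw [hφ p f z, hφ, hφ]
  refine Prod.ext ?_ (Prod.ext ?_ ?_)
  all_goals
    simp only [map_add, map_sub, map_neg, map_smul, hst, Prod.fst_zero, Prod.snd_zero]
    match_scalars <;> field_simp <;> ring

/-- A constant observer gain that makes the error dynamics of the observable part nilpotent. The
entries place all poles of the double integrator (clock differences without drift) and of the triple
integrator (clock differences with drift) at the origin. -/
lemma exists_deadbeat_gain : ∃ K : Matrix (ObsIx c M) (Meas c M) ℝ, (E.Aoo - K * E.Co) ^ 3 = 0 := by
  obtain ⟨S, hS⟩ := E.exists_leftInverse_V_mul_J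
  set T := E.V * E.J with hT
  have hτ := E.τ_pos.ne'
  let K : Matrix (ObsIx c M) (Meas c M) ℝ := fromRows
    (Matrix.of fun ai l => (![(2 : ℝ) • 1 + T * S, (1 / E.τ) • (1 + (3 / 2 : ℝ) • (T * S))] :
      Fin 2 → Matrix (Meas c M) (Meas c M) ℝ) ai.1 ai.2 l) ((1 / E.τ ^ 2) • S)
  let e : (ObsIx c M → ℝ) → (Meas c M → ℝ) × (Meas c M → ℝ) × (Fin M → ℝ) := fun v =>
    (fun i => v (Sum.inl (0, i)), fun i => v (Sum.inl (1, i)), fun j => v (Sum.inr j))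
  have he : ∀ v, e v = 0 → v = 0 := fun v hv => by
    simp only [e, Prod.mk_eq_zero, funext_iff, Pi.zero_apply] at hv
    funext k
    rcases k with ⟨a, i⟩ | j
    · fin_cases a
      exacts [hv.1 i, hv.2.1 i]
    · exact hv.2.2 j
  let t := T.mulVecLin
  let s := S.mulVecLin
  have hst : ∀ z, s (t z) = z := fun z => by
    simp [s, t, mulVec_mulVec, hS]
  let φ : (Meas c M → ℝ) × (Meas c M → ℝ) × (Fin M → ℝ) →
      (Meas c M → ℝ) × (Meas c M → ℝ) × (Fin M → ℝ) := fun x =>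
    (-x.1 - t (s x.1) + E.τ • x.2.1 + (E.τ ^ 2 / 2) • t x.2.2,
      x.2.1 + E.τ • t x.2.2 - (1 / E.τ) • (x.1 + (3 / 2 : ℝ) • t (s x.1)),
      x.2.2 - (1 / E.τ ^ 2) • s x.1)
  have hAp : ∀ v i, (E.Aoo *ᵥ v) (Sum.inl (0, i)) = v (Sum.inl (0, i)) +
      E.τ * v (Sum.inl (1, i)) + E.τ ^ 2 / 2 * (T *ᵥ fun j => v (Sum.inr j)) i := fun v i => by
    simp [Aoo, A, β, ← hT, mulVec, dotProduct, Fintype.sum_prod_type, Matrix.one_apply,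
      Finset.mul_sum, mul_assoc]
  have hAf : ∀ v i, (E.Aoo *ᵥ v) (Sum.inl (1, i)) =
      v (Sum.inl (1, i)) + E.τ * (T *ᵥ fun j => v (Sum.inr j)) i := fun v i => by
    simp [Aoo, A, β, ← hT, mulVec, dotProduct, Fintype.sum_prod_type, Matrix.one_apply,
      Finset.mul_sum, mul_assoc]
  have hAz : ∀ v j, (E.Aoo *ᵥ v) (Sum.inr j) = v (Sum.inr j) := fun v j => by
    simp [Aoo, mulVec, dotProduct, Matrix.one_apply]
  have hC : ∀ v, E.Co *ᵥ v = fun i => v (Sum.inl (0, i)) := fun v => by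
    funext i
    simp [Co, C, mulVec, dotProduct, Fintype.sum_prod_type, Matrix.one_apply]
  have hKp : ∀ y i, (K *ᵥ y) (Sum.inl (0, i)) = 2 * y i + (T *ᵥ (S *ᵥ y)) i := fun y i => by
    change (((2 : ℝ) • (1 : Matrix (Meas c M) (Meas c M) ℝ) + T * S) *ᵥ y) i = _
    simp [add_mulVec, smul_mulVec, mulVec_mulVec]
  have hKf : ∀ y i, (K *ᵥ y) (Sum.inl (1, i)) =
      1 / E.τ * (y i + 3 / 2 * (T *ᵥ (S *ᵥ y)) i) := fun y i => by
    change (((1 / E.τ) • ((1 : Matrix (Meas c M) (Meas c M) ℝ) + (3 / 2 : ℝ) • (T * S))) *ᵥ y) i = _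
    simp [add_mulVec, smul_mulVec, mulVec_mulVec, mul_add]
  have hKz : ∀ y j, (K *ᵥ y) (Sum.inr j) = 1 / E.τ ^ 2 * (S *ᵥ y) j := fun y j => by
    change (((1 / E.τ ^ 2) • S) *ᵥ y) j = _
    simp [smul_mulVec]
  have hφ : ∀ v, e ((E.Aoo - K * E.Co) *ᵥ v) = φ (e v) := fun v => by
    refine Prod.ext ?_ (Prod.ext ?_ ?_) <;> funext i
    · simp only [e, φ, sub_mulVec, ← mulVec_mulVec, hC, Pi.sub_apply, hAp, hKp, t, s,
        mulVecLin_apply, Pi.add_apply, Pi.neg_apply, Pi.smul_apply, smul_eq_mul]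
      ring
    · simp only [e, φ, sub_mulVec, ← mulVec_mulVec, hC, Pi.sub_apply, hAf, hKf, t, s,
        mulVecLin_apply, Pi.add_apply, Pi.smul_apply, smul_eq_mul]
    · simp only [e, φ, sub_mulVec, ← mulVec_mulVec, hC, Pi.sub_apply, hAz, hKz, s,
        mulVecLin_apply, Pi.smul_apply, smul_eq_mul]
  refine ⟨K, Matrix.ext_of_mulVec_single fun i => ?_⟩
  rw [zero_mulVec]
  refine he _ ?_
  rw [pow_three, ← mulVec_mulVec, ← mulVec_mulVec, hφ, hφ, hφ]
  exact deadbeat_integrators hst hτ (fun p f z => rfl) _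

end MixedEnsemble

/-! ### The transformed realization -/

section KroneckerProducts

variable {l m n : Type*} [Fintype m]

lemma one_kronecker_mul_idKronCol (X : Matrix l m ℝ) (v : m → ℝ) :
    ((1 : Matrix (Fin 2) (Fin 2) ℝ) ⊗ₖ X) * idKronCol v = idKronCol (X *ᵥ v) := by
  ext ⟨a, i⟩ b
  simp [Matrix.mul_apply, Fintype.sum_prod_type, Matrix.one_apply, mulVec, dotProduct]

lemma idKronRow_mul_one_kronecker (X : Matrix m n ℝ) (v : m → ℝ) :
    idKronRow v * ((1 : Matrix (Fin 2) (Fin 2) ℝ) ⊗ₖ X) = idKronRow (v ᵥ* X) := by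
  ext a ⟨b, i⟩
  simp [Matrix.mul_apply, Fintype.sum_prod_type, Matrix.one_apply, vecMul, dotProduct]

lemma idKronRow_mul_idKronCol (v w : m → ℝ) :
    idKronRow v * idKronCol w = (v ⬝ᵥ w) • (1 : Matrix (Fin 2) (Fin 2) ℝ) := by
  ext a b
  simp [Matrix.mul_apply, Fintype.sum_prod_type, Matrix.one_apply, dotProduct]

lemma one_kronecker_mul_kronCol (X : Matrix l m ℝ) (b : Fin 2 → ℝ) (Y : Matrix m n ℝ) :
    ((1 : Matrix (Fin 2) (Fin 2) ℝ) ⊗ₖ X) * kronCol b Y = kronCol b (X * Y) := by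
  ext ⟨a, i⟩ j
  fin_cases a <;> simp [Matrix.mul_apply, Fintype.sum_prod_type, Matrix.one_apply, Finset.mul_sum,
    mul_left_comm]

lemma kronRow_mul_one_kronecker (b : Fin 2 → ℝ) (X : Matrix l m ℝ) (Y : Matrix m n ℝ) :
    kronRow b X * ((1 : Matrix (Fin 2) (Fin 2) ℝ) ⊗ₖ Y) = kronRow b (X * Y) := by
  ext i ⟨a, j⟩
  fin_cases a <;> simp [Matrix.mul_apply, Fintype.sum_prod_type, Matrix.one_apply, Finset.mul_sum,
    mul_assoc]

lemma idKronRow_mul_kronCol (v : m → ℝ) (b : Fin 2 → ℝ) (Y : Matrix m n ℝ) :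
    idKronRow v * kronCol b Y = Matrix.of fun a j => b a * (v ᵥ* Y) j := by
  ext a j
  simp [Matrix.mul_apply, Fintype.sum_prod_type, Matrix.one_apply, Finset.mul_sum, mul_left_comm,
    vecMul, dotProduct]

lemma idKronRow_mul_kronecker_one [DecidableEq m] (v : m → ℝ) (X : Matrix (Fin 2) (Fin 2) ℝ) :
    idKronRow v * (X ⊗ₖ (1 : Matrix m m ℝ)) = X * idKronRow v := by
  ext a ⟨b, i⟩
  simp [Matrix.mul_apply, Fintype.sum_prod_type, Matrix.one_apply, mul_comm]

end KroneckerProducts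

namespace MixedEnsemble

variable {c M : ℕ} (E : MixedEnsemble c M) (D : Weighting c M)

lemma T_mul_Tinv : E.T D * E.Tinv D = 1 := by
  have h1 := E.To_mul_rightInverse D
  have hV : E.V *ᵥ 1 = 0 := E.V_mulVec_const 1
  have hq : D.q ⬝ᵥ 1 = 1 := q_dotProduct_const D 1
  have h12 : E.To * (fromRows (idKronCol 1) 0 : Matrix (StateIx c M) (Fin 2) ℝ) = 0 := by
    rw [To, fromBlocks_mul_fromRows, one_kronecker_mul_idKronCol, hV]
    ext (⟨a, i⟩ | j) b <;> simp
  have h21 : E.Tu D * (fromBlocks ((1 : Matrix (Fin 2) (Fin 2) ℝ) ⊗ₖ E.Vplus D) 0 0 1 :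
      Matrix (StateIx c M) (ObsIx c M) ℝ) = 0 := by
    rw [Tu, fromCols_mul_fromBlocks, idKronRow_mul_one_kronecker, q_vecMul_Vplus]
    ext a (⟨b, i⟩ | j) <;> simp
  have h22 : E.Tu D * (fromRows (idKronCol 1) 0 : Matrix (StateIx c M) (Fin 2) ℝ) = 1 := by
    rw [Tu, fromCols_mul_fromRows, idKronRow_mul_idKronCol, hq]
    simp
  rw [T, Tinv, fromRows_mul_fromCols, h1, h12, h21, h22, fromBlocks_one]

lemma Tinv_mul_T : E.Tinv D * E.T D = 1 := by
  refine (mul_eq_one_comm_of_card_eq _ _ _ ?_).1 (E.T_mul_Tinv D)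
  have := E.cesium_pos
  simp
  omega

lemma T_mul_ensA : E.T D * E.ensA = E.transA D * E.T D := by
  rw [T, ensA, transA, fromRows_mul, fromBlocks_mul_fromRows]
  congr 1
  · simp [To, Aoo, fromBlocks_multiply, one_kronecker_mul_kronCol, ← mul_kronecker_mul]
  · simp [Tu, Auo, To, fromCols_mul_fromBlocks, idKronRow_mul_kronecker_one, idKronRow_mul_kronCol,
      mul_fromCols]
    ext a (i | j) <;> simp

lemma T_mul_ensB : E.T D * E.ensB = E.transB D := by
  rw [T, ensB, transB, fromRows_mul]
  congr 1
  · simp [To, Bo, fromBlocks_mul_fromRows, one_kronecker_mul_kronCol]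
  · simp [Tu, Bu, fromCols_mul_fromRows, idKronRow_mul_kronCol]

lemma transC_mul_T : E.transC * E.T D = E.ensC := by
  simp [transC, T, ensC, Co, To, fromCols_mul_fromRows, fromCols_mul_fromBlocks,
    kronRow_mul_one_kronecker]

end MixedEnsemble

namespace MixedEnsemble

variable {c M : ℕ} (E : MixedEnsemble c M) (D : Weighting c M)

/-! ### The blocks of the Kalman filter -/

lemma posDef_r_smul_one : (E.r • (1 : Matrix (Meas c M) (Meas c M) ℝ)).PosDef :=
  PosDef.one.smul E.r_pos

lemma A_sub_one_mul_self : (E.A - 1) * (E.A - 1) = 0 := by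
  ext a b
  fin_cases a <;> fin_cases b <;> simp [A, Matrix.mul_apply]

/-- The Riccati map of the observable part. -/
def riccatiStep : Matrix (ObsIx c M) (ObsIx c M) ℝ → Matrix (ObsIx c M) (ObsIx c M) ℝ :=
  Riccati.step E.Aoo E.Co (E.To * E.Q * E.Toᵀ) (E.r • 1)

/-- The closed-loop matrix of the observable part. -/
def riccatiLoop (P : Matrix (ObsIx c M) (ObsIx c M) ℝ) : Matrix (ObsIx c M) (ObsIx c M) ℝ :=
  Riccati.closedLoop E.Aoo E.Co (E.r • 1) P

lemma isRiccatiSolution_iff (P : Matrix (ObsIx c M) (ObsIx c M) ℝ) :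
    E.IsRiccatiSolution P ↔ P.PosSemidef ∧ E.riccatiStep P = P := by
  have h : E.riccatiStep P = E.To * E.Q * E.Toᵀ + E.Aoo * P * E.Aooᵀ -
      E.Aoo * P * E.Coᵀ * (E.Co * P * E.Coᵀ + E.r • 1)⁻¹ * E.Co * P * E.Aooᵀ := by
    simp only [riccatiStep, Riccati.step, Riccati.gain, Matrix.sub_mul, Matrix.mul_sub,
      Matrix.one_mul, Matrix.mul_assoc]
    abel
  rw [IsRiccatiSolution, ← h]
  exact and_congr_right fun _ => eq_comm

lemma one_sub_steadyGainObs_mul {P : Matrix (ObsIx c M) (ObsIx c M) ℝ} (hP : P.PosSemidef) :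
    (1 - E.steadyGainObs P * E.Co) * P = P * (1 - E.steadyGainObs P * E.Co)ᵀ :=
  Riccati.one_sub_gain_mul E.posDef_r_smul_one hP

lemma riccatiLoop_transpose (P : Matrix (ObsIx c M) (ObsIx c M) ℝ) :
    (E.riccatiLoop P)ᵀ = (1 - E.steadyGainObs P * E.Co)ᵀ * E.Aooᵀ :=
  transpose_mul _ _

lemma isSteinSolution_iff {P : Matrix (ObsIx c M) (ObsIx c M) ℝ} (hP : P.PosSemidef)
    (X : Matrix (Fin 2) (ObsIx c M) ℝ) :
    E.IsSteinSolution D P X ↔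
      X = (E.A * X + E.Auo D * P) * (E.riccatiLoop P)ᵀ + E.Tu D * E.Q * E.Toᵀ := by
  have h : (E.A * X + E.Auo D * P) * (E.riccatiLoop P)ᵀ + E.Tu D * E.Q * E.Toᵀ =
      E.Tu D * E.Q * E.Toᵀ + E.A * X * E.Aooᵀ - E.A * X * E.Coᵀ * (E.steadyGainObs P)ᵀ * E.Aooᵀ
        + E.Auo D * P * E.Aooᵀ - E.Auo D * E.steadyGainObs P * E.Co * P * E.Aooᵀ := by
    rw [riccatiLoop_transpose, Matrix.add_mul, ← Matrix.mul_assoc (E.Auo D * P),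
      Matrix.mul_assoc (E.Auo D), ← E.one_sub_steadyGainObs_mul hP, transpose_sub, transpose_one,
      transpose_mul]
    simp only [Matrix.sub_mul, Matrix.mul_sub, Matrix.one_mul, Matrix.mul_assoc]
    abel
  rw [h, IsSteinSolution]

variable (P : Matrix (TransIx c M) (TransIx c M) ℝ)

lemma kalmanGain_eq : E.kalmanGain P =
    fromRows (E.steadyGainObs P.toBlocks₁₁) (E.steadyGainUnobs P.toBlocks₁₁ P.toBlocks₂₁) := by
  have h : P * E.transCᵀ = fromRows (P.toBlocks₁₁ * E.Coᵀ) (P.toBlocks₂₁ * E.Coᵀ) := by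
    conv_lhs => rw [← fromBlocks_toBlocks P]
    rw [transC, transpose_fromCols, fromBlocks_mul_fromRows]
    simp
  rw [kalmanGain, Matrix.mul_assoc E.transC, h, fromRows_mul]
  simp only [transC, fromCols_mul_fromRows, Matrix.zero_mul, add_zero, steadyGainObs,
    steadyGainUnobs, Matrix.mul_assoc]

lemma updateCov_eq : E.updateCov P = P - fromRows
    (E.steadyGainObs P.toBlocks₁₁) (E.steadyGainUnobs P.toBlocks₁₁ P.toBlocks₂₁) *
      fromCols (E.Co * P.toBlocks₁₁) (E.Co * P.toBlocks₁₂) := by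
  have h : E.transC * P = fromCols (E.Co * P.toBlocks₁₁) (E.Co * P.toBlocks₁₂) := by
    conv_lhs => rw [← fromBlocks_toBlocks P]
    rw [transC, fromCols_mul_fromBlocks]
    simp
  rw [updateCov, kalmanGain_eq, Matrix.sub_mul, Matrix.one_mul, Matrix.mul_assoc, h]

lemma updateCov_toBlocks₁₁ : (E.updateCov P).toBlocks₁₁ =
    (1 - E.steadyGainObs P.toBlocks₁₁ * E.Co) * P.toBlocks₁₁ := by
  rw [updateCov_eq, fromRows_mul_fromCols, Matrix.sub_mul, Matrix.one_mul, Matrix.mul_assoc]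
  rfl

lemma updateCov_toBlocks₂₁ (hP : P.toBlocks₁₁.PosSemidef) : (E.updateCov P).toBlocks₂₁ =
    P.toBlocks₂₁ * (1 - E.steadyGainObs P.toBlocks₁₁ * E.Co)ᵀ := by
  have h1 := Riccati.innovation_mul_gain_transpose (H := E.Co) E.posDef_r_smul_one hP
  have h2 : (E.steadyGainObs P.toBlocks₁₁)ᵀ =
      (E.Co * P.toBlocks₁₁ * E.Coᵀ + E.r • 1)⁻¹ * (E.Co * P.toBlocks₁₁) := by
    have h3 := Matrix.nonsing_inv_mul_cancel_left _ (E.steadyGainObs P.toBlocks₁₁)ᵀ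
      (Riccati.isUnit_det_innovation (H := E.Co) E.posDef_r_smul_one hP)
    exact h3.symm.trans (congrArg _ h1)
  have h4 : E.steadyGainUnobs P.toBlocks₁₁ P.toBlocks₂₁ * (E.Co * P.toBlocks₁₁) =
      P.toBlocks₂₁ * (E.Coᵀ * (E.steadyGainObs P.toBlocks₁₁)ᵀ) := by
    rw [h2, steadyGainUnobs]
    simp only [Matrix.mul_assoc]
  rw [updateCov_eq, fromRows_mul_fromCols, transpose_sub, transpose_one, transpose_mul,
    Matrix.mul_sub, Matrix.mul_one, ← h4]
  rfl

lemma predictCov_eq : E.predictCov D P = fromBlocks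
    (E.Aoo * P.toBlocks₁₁ * E.Aooᵀ + E.To * E.Q * E.Toᵀ)
    (E.Aoo * P.toBlocks₁₁ * (E.Auo D)ᵀ + E.Aoo * P.toBlocks₁₂ * E.Aᵀ + E.To * E.Q * (E.Tu D)ᵀ)
    ((E.Auo D * P.toBlocks₁₁ + E.A * P.toBlocks₂₁) * E.Aooᵀ + E.Tu D * E.Q * E.Toᵀ)
    ((E.Auo D * P.toBlocks₁₁ + E.A * P.toBlocks₂₁) * (E.Auo D)ᵀ +
      (E.Auo D * P.toBlocks₁₂ + E.A * P.toBlocks₂₂) * E.Aᵀ + E.Tu D * E.Q * (E.Tu D)ᵀ) := by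
  conv_lhs => rw [predictCov, ← fromBlocks_toBlocks P]
  rw [transA, T, transpose_fromRows, fromRows_mul, fromRows_mul_fromCols, fromBlocks_multiply,
    fromBlocks_transpose, fromBlocks_multiply, fromBlocks_add]
  simp

lemma predictCov_toBlocks₁₁ : (E.predictCov D P).toBlocks₁₁ =
    E.Aoo * P.toBlocks₁₁ * E.Aooᵀ + E.To * E.Q * E.Toᵀ := by
  rw [predictCov_eq, toBlocks_fromBlocks₁₁]

lemma predictCov_toBlocks₂₁ : (E.predictCov D P).toBlocks₂₁ =
    (E.Auo D * P.toBlocks₁₁ + E.A * P.toBlocks₂₁) * E.Aooᵀ + E.Tu D * E.Q * E.Toᵀ := by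
  rw [predictCov_eq, toBlocks_fromBlocks₂₁]

/-- The observable block of the prior covariance follows the Riccati recursion. -/
lemma priorCov_toBlocks₁₁ (k : ℕ) : (E.priorCov D P k).toBlocks₁₁ =
    E.riccatiStep^[k] (E.Aoo * P.toBlocks₁₁ * E.Aooᵀ + E.To * E.Q * E.Toᵀ) := by
  induction k with
  | zero => exact E.predictCov_toBlocks₁₁ D P
  | succ k ih =>
    rw [Function.iterate_succ_apply', ← ih]
    change (E.predictCov D (E.updateCov (E.priorCov D P k))).toBlocks₁₁ = _
    rw [predictCov_toBlocks₁₁, updateCov_toBlocks₁₁]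
    rfl

lemma priorCov_succ_toBlocks₂₁ {k : ℕ} (hP : (E.priorCov D P k).toBlocks₁₁.PosSemidef) :
    (E.priorCov D P (k + 1)).toBlocks₂₁ =
      (E.A * (E.priorCov D P k).toBlocks₂₁ + E.Auo D * (E.priorCov D P k).toBlocks₁₁) *
        (E.riccatiLoop (E.priorCov D P k).toBlocks₁₁)ᵀ + E.Tu D * E.Q * E.Toᵀ := by
  change (E.predictCov D (E.updateCov (E.priorCov D P k))).toBlocks₂₁ = _
  rw [predictCov_toBlocks₂₁, updateCov_toBlocks₁₁, updateCov_toBlocks₂₁ _ _ hP,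
    E.one_sub_steadyGainObs_mul hP, riccatiLoop_transpose, add_comm (E.A * _)]
  simp only [Matrix.add_mul, Matrix.mul_assoc]

lemma gainObs_eq (k : ℕ) :
    E.gainObs D P k = E.steadyGainObs (E.priorCov D P k).toBlocks₁₁ := by
  rw [gainObs, kalmanGain_eq, toRows₁_fromRows]

lemma gainUnobs_eq (k : ℕ) :
    E.gainUnobs D P k =
      E.steadyGainUnobs (E.priorCov D P k).toBlocks₁₁ (E.priorCov D P k).toBlocks₂₁ := by
  rw [gainUnobs, kalmanGain_eq, toRows₂_fromRows]

/-! ### Steady state -/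

variable {P} {Ps : Matrix (ObsIx c M) (ObsIx c M) ℝ} {X : Matrix (Fin 2) (ObsIx c M) ℝ}

lemma existsUnique_isRiccatiSolution (D : Weighting c M) : ∃! P, E.IsRiccatiSolution P := by
  obtain ⟨K, hK⟩ := E.exists_deadbeat_gain
  have hR := E.posDef_r_smul_one
  have hG := E.To_mul_Q_mul_To_posDef D
  obtain ⟨P, hP, hfix⟩ := Riccati.exists_fixedPoint hR hG hK
  refine ⟨P, (E.isRiccatiSolution_iff P).2 ⟨hP, hfix⟩, fun P' hP' => ?_⟩
  obtain ⟨hP', hfix'⟩ := (E.isRiccatiSolution_iff P').1 hP'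
  -- the orbit of the fixed point `P'` is constant, and converges to `P`
  have h : Tendsto (fun k => E.riccatiStep^[k] P') atTop (𝓝 P) :=
    Riccati.tendsto_iterate hR hG hK hP hfix hP'
  simp only [Function.iterate_fixed hfix'] at h
  exact tendsto_nhds_unique tendsto_const_nhds h

attribute [local instance] Matrix.frobeniusNormedAddCommGroup in
lemma exists_riccatiLoop_pow_bound (D : Weighting c M) (h : E.IsRiccatiSolution Ps) :
    ∃ b θ : ℝ, 0 ≤ b ∧ 0 ≤ θ ∧ θ < 1 ∧ ∀ k, ‖E.riccatiLoop Ps ^ k‖ ≤ b * θ ^ k := by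
  obtain ⟨K, hK⟩ := E.exists_deadbeat_gain
  obtain ⟨hP, hfix⟩ := (E.isRiccatiSolution_iff Ps).1 h
  exact Riccati.exists_closedLoop_pow_bound E.posDef_r_smul_one (E.To_mul_Q_mul_To_posDef D) hK hP
    hfix

attribute [local instance] Matrix.frobeniusNormedAddCommGroup in
lemma isSchurStable_riccatiLoop (D : Weighting c M) (h : E.IsRiccatiSolution Ps) :
    IsSchurStable (E.riccatiLoop Ps) := by
  obtain ⟨b, θ, -, hθ0, hθ1, hbd⟩ := E.exists_riccatiLoop_pow_bound D h
  refine Riccati.isSchurStable_of_tendsto_pow (squeeze_zero_norm hbd ?_)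
  simpa using (tendsto_pow_atTop_nhds_zero_of_lt_one hθ0 hθ1).const_mul b

lemma isSchurStable_riccatiLoop_kronecker (D : Weighting c M) (h : E.IsRiccatiSolution Ps) :
    IsSchurStable (E.riccatiLoop Ps ⊗ₖ E.A) := by
  obtain ⟨b, θ, -, hθ0, hθ1, hbd⟩ := E.exists_riccatiLoop_pow_bound D h
  exact Riccati.isSchurStable_of_tendsto_pow
    (Riccati.tendsto_kronecker_pow E.A_sub_one_mul_self hθ0 hθ1 hbd)

lemma existsUnique_isSteinSolution (h : E.IsRiccatiSolution Ps) :
    ∃! X, E.IsSteinSolution D Ps X := by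
  obtain ⟨b, θ, -, hθ0, hθ1, hbd⟩ := E.exists_riccatiLoop_pow_bound D h
  have h1 := Riccati.existsUnique_stein E.A_sub_one_mul_self hθ0 hθ1 hbd
    (E.Auo D * Ps * (E.riccatiLoop Ps)ᵀ + E.Tu D * E.Q * E.Toᵀ)
  simpa only [E.isSteinSolution_iff D h.1, Matrix.add_mul, add_assoc] using h1

lemma priorCov_toBlocks₁₁_posSemidef (hP : P.PosSemidef) (k : ℕ) :
    (E.priorCov D P k).toBlocks₁₁.PosSemidef := by
  have hG := (E.To_mul_Q_mul_To_posDef D).posSemidef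
  rw [priorCov_toBlocks₁₁]
  exact Riccati.iterate_posSemidef E.posDef_r_smul_one hG
    ((Riccati.posSemidef_conj (hP.submatrix Sum.inl) _).add hG) k

lemma tendsto_priorCov_toBlocks₁₁ (h : E.IsRiccatiSolution Ps) (hP : P.PosSemidef) :
    Tendsto (fun k => (E.priorCov D P k).toBlocks₁₁) atTop (𝓝 Ps) := by
  obtain ⟨K, hK⟩ := E.exists_deadbeat_gain
  obtain ⟨hPs, hfix⟩ := (E.isRiccatiSolution_iff Ps).1 h
  have h0 := E.priorCov_toBlocks₁₁_posSemidef D hP 0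
  rw [priorCov_toBlocks₁₁] at h0
  simp only [priorCov_toBlocks₁₁]
  exact Riccati.tendsto_iterate E.posDef_r_smul_one (E.To_mul_Q_mul_To_posDef D) hK hPs hfix h0

lemma tendsto_priorCov_toBlocks₂₁ (h : E.IsRiccatiSolution Ps) (hX : E.IsSteinSolution D Ps X)
    (hP : P.PosSemidef) : Tendsto (fun k => (E.priorCov D P k).toBlocks₂₁) atTop (𝓝 X) := by
  obtain ⟨K, hK⟩ := E.exists_deadbeat_gain
  obtain ⟨hPs, hfix⟩ := (E.isRiccatiSolution_iff Ps).1 h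
  have hpos := E.priorCov_toBlocks₁₁_posSemidef D hP
  have h0 : (E.priorCov D P 0).toBlocks₁₁.PosSemidef := hpos 0
  have hiter : ∀ k, (E.priorCov D P k).toBlocks₁₁ =
      E.riccatiStep^[k] (E.priorCov D P 0).toBlocks₁₁ := fun k => by
    rw [priorCov_toBlocks₁₁, priorCov_toBlocks₁₁]
    rfl
  refine Riccati.tendsto_cross E.posDef_r_smul_one (E.To_mul_Q_mul_To_posDef D) hK hPs hfix
    E.A_sub_one_mul_self ((E.isSteinSolution_iff D hPs X).1 hX) h0 fun k => ?_
  rw [E.priorCov_succ_toBlocks₂₁ D P (hpos k), hiter]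
  rfl

lemma priorCov_steady (h : E.IsRiccatiSolution Ps) (hX : E.IsSteinSolution D Ps X)
    (h₁₁ : P.toBlocks₁₁ = (1 - E.steadyGainObs Ps * E.Co) * Ps)
    (h₂₁ : P.toBlocks₂₁ = X * (1 - E.steadyGainObs Ps * E.Co)ᵀ) (k : ℕ) :
    (E.priorCov D P k).toBlocks₁₁ = Ps ∧ (E.priorCov D P k).toBlocks₂₁ = X := by
  obtain ⟨hPs, hfix⟩ := (E.isRiccatiSolution_iff Ps).1 h
  have hX' := (E.isSteinSolution_iff D hPs X).1 hX
  have h1 : ∀ k, (E.priorCov D P k).toBlocks₁₁ = Ps := fun k => by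
    have h0 : E.Aoo * P.toBlocks₁₁ * E.Aooᵀ + E.To * E.Q * E.Toᵀ = E.riccatiStep Ps := by
      rw [h₁₁]
      rfl
    rw [priorCov_toBlocks₁₁, h0, hfix, Function.iterate_fixed hfix]
  refine ⟨h1 k, ?_⟩
  induction k with
  | zero =>
    change (E.predictCov D P).toBlocks₂₁ = X
    rw [predictCov_toBlocks₂₁, h₁₁, h₂₁, E.one_sub_steadyGainObs_mul hPs]
    conv_rhs => rw [hX', riccatiLoop_transpose]
    rw [add_comm (E.Auo D * _)]
    simp only [Matrix.add_mul, Matrix.mul_assoc]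
  | succ k ih =>
    rw [E.priorCov_succ_toBlocks₂₁ D P (by rw [h1]; exact hPs), ih, h1]
    exact hX'.symm

lemma transC_mulVec (η : TransIx c M → ℝ) :
    E.transC *ᵥ η = E.Co *ᵥ fun i => η (Sum.inl i) := by
  rw [transC, fromCols_mulVec, zero_mulVec, add_zero]
  rfl

end MixedEnsemble

end

theorem theorem1 {c M : ℕ} (E : MixedEnsemble c M) (D : Weighting c M) :
    -- the decomposition is an invertible change of coordinates and yields the block realization
    (E.T D * E.Tinv D = 1 ∧ E.Tinv D * E.T D = 1 ∧
      E.T D * E.ensA * E.Tinv D = E.transA D ∧ E.T D * E.ensB = E.transB D ∧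
      E.ensC * E.Tinv D = E.transC) ∧
    -- the Riccati equation of the observable part has a unique solution `P`
    (∃! P, E.IsRiccatiSolution P) ∧
    ∀ P, E.IsRiccatiSolution P →
      -- the closed-loop matrices are stable
      IsSchurStable (E.Aoo * (1 - E.steadyGainObs P * E.Co)) ∧
      IsSchurStable ((E.Aoo * (1 - E.steadyGainObs P * E.Co)) ⊗ₖ E.A) ∧
      -- the cross-covariance equation has a unique solution `X`
      (∃! X, E.IsSteinSolution D P X) ∧
      ∀ X, E.IsSteinSolution D P X →
        -- the covariances and gains of the Kalman filter converge to their steady-state values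
        (∀ P₀ : Matrix (TransIx c M) (TransIx c M) ℝ, P₀.PosSemidef →
          Tendsto (fun k => (E.priorCov D P₀ k).toBlocks₁₁) atTop (𝓝 P) ∧
          Tendsto (fun k => (E.postCov D P₀ k).toBlocks₁₁) atTop
            (𝓝 ((1 - E.steadyGainObs P * E.Co) * P)) ∧
          Tendsto (fun k => (E.priorCov D P₀ k).toBlocks₂₁) atTop (𝓝 X) ∧
          Tendsto (fun k => E.gainObs D P₀ k) atTop (𝓝 (E.steadyGainObs P)) ∧
          Tendsto (fun k => E.gainUnobs D P₀ k) atTop (𝓝 (E.steadyGainUnobs P X))) ∧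
        -- in steady state the Kalman filter is the filter with these constant gains
        (∀ P₀ : Matrix (TransIx c M) (TransIx c M) ℝ,
          P₀.toBlocks₁₁ = (1 - E.steadyGainObs P * E.Co) * P →
          P₀.toBlocks₂₁ = X * (1 - E.steadyGainObs P * E.Co)ᵀ →
          (∀ k, (E.priorCov D P₀ k).toBlocks₁₁ = P ∧ (E.priorCov D P₀ k).toBlocks₂₁ = X ∧
            E.gainObs D P₀ k = E.steadyGainObs P ∧
            E.gainUnobs D P₀ k = E.steadyGainUnobs P X) ∧
          ∀ (u : ℕ → Clock c M → ℝ) (y : ℕ → Meas c M → ℝ) (ηm η : ℕ → TransIx c M → ℝ),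
            E.IsTransformedKalmanFilter D P₀ u y ηm η ↔
              E.IsConstantGainFilter D (E.steadyGainObs P) (E.steadyGainUnobs P X) u y ηm η) := by
  refine ⟨⟨E.T_mul_Tinv D, E.Tinv_mul_T D, ?_, E.T_mul_ensB D, ?_⟩,
    E.existsUnique_isRiccatiSolution D, fun P hP => ⟨E.isSchurStable_riccatiLoop D hP,
      E.isSchurStable_riccatiLoop_kronecker D hP, E.existsUnique_isSteinSolution D hP,
      fun X hX => ⟨fun P₀ hP₀ => ?_, fun P₀ h₁₁ h₂₁ => ?_⟩⟩⟩
  · rw [E.T_mul_ensA, Matrix.mul_assoc, E.T_mul_Tinv, Matrix.mul_one]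
  · rw [← E.transC_mul_T D, Matrix.mul_assoc, E.T_mul_Tinv, Matrix.mul_one]
  · have h1 := E.tendsto_priorCov_toBlocks₁₁ D hP hP₀
    have h2 := E.tendsto_priorCov_toBlocks₂₁ D hP hX hP₀
    have hR := E.posDef_r_smul_one
    refine ⟨h1, ?_, h2, ?_, ?_⟩
    · rw [← tendsto_add_atTop_iff_nat 1]
      refine (Riccati.tendsto_one_sub_gain_mul (H := E.Co) hR hP.1 h1).congr fun k => ?_
      exact (E.updateCov_toBlocks₁₁ (E.priorCov D P₀ k)).symm
    · simp only [E.gainObs_eq]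
      exact Riccati.tendsto_gain (H := E.Co) hR hP.1 h1
    · simp only [E.gainUnobs_eq]
      exact Riccati.tendsto_matrix_mul (Riccati.tendsto_matrix_mul h2 tendsto_const_nhds)
        (Riccati.tendsto_innovation_inv hR hP.1 h1)
  · have h := E.priorCov_steady D hP hX h₁₁ h₂₁
    refine ⟨fun k => ⟨(h k).1, (h k).2, ?_, ?_⟩, fun u y ηm η => forall_congr' fun k => ?_⟩
    · rw [E.gainObs_eq, (h k).1]
    · rw [E.gainUnobs_eq, (h k).1, (h k).2]
    · rw [E.kalmanGain_eq, (h k).1, (h k).2, E.transC_mulVec]
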